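/- Let $(\Omega,\mathcal A,\mathbb P)$ be a probability space, $\theta:\Omega\to\Omega$ a bijective bimeasurable transformation preserving $\mathbb P$, and $\mathcal F_0\subseteq\mathcal A$ a sub-$\sigma$-algebra with $\mathcal F_0\subseteq\theta^{-1}(\mathcal F_0)$. Let $Y_0$ be a real-valued $\mathcal F_0$-measurable random variable with distribution $P_{Y_0}$, let $Y_i=Y_0\circ\theta^i$, and write ${\bf Y}=(Y_i)$. For an integrable random variable $X$ put $X^{(0)}=X-\mathbb E(X)$. For a random vector $(Z_1,\dots,Z_l)$ put $$\phi(\mathcal F_0,(Z_1,\dots,Z_l))=\sup_{x\in\mathbb R^l}\Big\|\mathbb E\Big(\prod_{j=1}^l({\bf 1}_{Z_j\le x_j})^{(0)}\,\Big|\,\mathcal F_0\Big)^{(0)}\Big\|_\infty ,$$ and, for $k\ge1$ and $n\ge0$, $$\phi_{k,{\bf Y}}(n)=\max_{1\le l\le k}\ \sup_{n\le i_1\le\dots\le i_l}\phi(\mathcal F_0,(Y_{i_1},\dots,Y_{i_l})).$$ For a probability measure $\mu$ on $\mathbb R$ and $M>0$, let $\mathrm{Mon}_2(M,\mu)$ be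 the set of functions $g:\mathbb R\to\mathbb R$ which are monotonic on some interval, null elsewhere, and satisfy $\int|g|^2\,d\mu\le M^2$. Let $\mathrm{Monm}_2(M,\mu)$ be the closure in $\mathbb L^1(\mu)$ of the set of finite sums $\sum_{\ell=1}^L a_\ell g_\ell$ with $g_\ell\in\mathrm{Mon}_2(M,\mu)$ and $\sum_{\ell=1}^L|a_\ell|\le1$. Assume that $$\sum_{k\ge1}k^{1/\sqrt3-1/2}\,\phi_{2,{\bf Y}}(k)^{1/2}<\infty ,$$ and let $f\in\mathrm{Monm}_2(M,P_{Y_0})$ for some $M>0$. Put $X_i=f(Y_i)-\mathbb E(f(Y_i))$ and $S_n=\sum_{k=1}^nX_k$. Then $C=16\sum_{k\ge0}\phi_{1,{\bf Y}}(k)^{1/2}$ is finite and $$\sum_{n>0}\frac1n\,\mathbb P\Big(\max_{1\le k\le n}|S_k|>3CM\sqrt{n\log\log n}\Big)<\infty .$$ (Here $\sqrt{n\log\log n}$ is read as $0$ for $n=1,2$; these two terms do not affect convergence.) -/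

import Mathlib

open MeasureTheory
open scoped ENNReal NNReal

namespace PhiLIL

/-- `Mon_p(M, μ)`: functions that are monotonic on some interval, null elsewhere, and satisfy
`μ(|f|^p) ≤ M^p`. -/
def Mon (p M : ℝ) (μ : Measure ℝ) : Set (ℝ → ℝ) :=
  {f | (∃ I : Set ℝ, I.OrdConnected ∧ (MonotoneOn f I ∨ AntitoneOn f I) ∧ ∀ x ∉ I, f x = 0) ∧
    ∫⁻ x, ENNReal.ofReal (|f x| ^ p) ∂μ ≤ ENNReal.ofReal (M ^ p)}

/-- Finite combinations `∑ a_ℓ f_ℓ` with `f_ℓ ∈ Mon_p(M, μ)` and `∑ |a_ℓ| ≤ 1`. -/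
def MonComb (p M : ℝ) (μ : Measure ℝ) : Set (ℝ → ℝ) :=
  {g | ∃ (L : ℕ) (a : Fin L → ℝ) (F : Fin L → ℝ → ℝ),
    (∀ l, F l ∈ Mon p M μ) ∧ ∑ l, |a l| ≤ 1 ∧ g = fun x => ∑ l, a l * F l x}

/-- `Monm_p(M, μ)`: (representatives of elements of) the closure in `L¹(μ)` of `MonComb p M μ`. -/
def MonClosure (p M : ℝ) (μ : Measure ℝ) : Set (ℝ → ℝ) :=
  {f | MemLp f 1 μ ∧ ∀ ε : ℝ≥0∞, 0 < ε → ∃ g ∈ MonComb p M μ, eLpNorm (f - g) 1 μ < ε}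

/-- `X^{(0)} = X - E X`. -/
noncomputable def center {Ω : Type*} [MeasurableSpace Ω] (P : Measure Ω) (X : Ω → ℝ) : Ω → ℝ :=
  fun ω => X ω - ∫ ω', X ω' ∂P

/-- `φ(F, (Y_1, …, Y_l))`: the supremum over `x ∈ ℝ^l` of the `L^∞` norm of
`(E (∏_j (1_{Y_j ≤ x_j})^{(0)} | F))^{(0)}`. -/
noncomputable def phi {Ω : Type*} (F : MeasurableSpace Ω) [MeasurableSpace Ω] (P : Measure Ω)
    {l : ℕ} (Y : Fin l → Ω → ℝ) : ℝ≥0∞ :=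
  ⨆ x : Fin l → ℝ, eLpNorm
    (center P (P[fun ω => ∏ j, center P ({ω' | Y j ω' ≤ x j}.indicator 1) ω | F])) ∞ P

/-- The coefficient `φ_{k,Y}(n)`, `n ≥ 0`, of a sequence `Y`: the supremum of
`φ(F, (Y_{i_1}, …, Y_{i_l}))` over `1 ≤ l ≤ k` and `n ≤ i_1 ≤ … ≤ i_l`. Only the terms of `Y` with
nonnegative index enter. The supremum is finite, since the conditional expectations in `phi` are
bounded by `1`. -/
noncomputable def phiCoeff {Ω : Type*} (F : MeasurableSpace Ω) [MeasurableSpace Ω] (P : Measure Ω)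
    (Y : ℕ → Ω → ℝ) (k n : ℕ) : ℝ :=
  (⨆ (l : ℕ) (_ : 1 ≤ l ∧ l ≤ k) (i : Fin l → ℕ) (_ : Monotone i ∧ ∀ j, n ≤ i j),
    phi F P (fun j => Y (i j))).toReal

/-- The partial sums `S_n = ∑_{k=1}^n (f(Y_k) - E f(Y_k))`. -/
noncomputable def partialSum {Ω : Type*} [MeasurableSpace Ω] (P : Measure Ω)
    (Y : ℕ → Ω → ℝ) (f : ℝ → ℝ) (n : ℕ) (ω : Ω) : ℝ :=
  ∑ k ∈ Finset.Icc 1 n, center P (fun ω' => f (Y k ω')) ω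

/-- `max_{1 ≤ k ≤ n} |S_k|`, for `n ≥ 1`. -/
noncomputable def maxPartialSum {Ω : Type*} [MeasurableSpace Ω] (P : Measure Ω)
    (Y : ℕ → Ω → ℝ) (f : ℝ → ℝ) (n : ℕ) (ω : Ω) : ℝ≥0 :=
  (Finset.Icc 1 n).sup fun k => ‖partialSum P Y f k ω‖₊

end PhiLIL

namespace PhiLIL

set_option linter.unusedSectionVars false

variable {Ω : Type*}

/-! Write e_k for the one-point coefficients φ_{1,Y}(k), s = Σ_{k≥1} √e_k, K² = M²(5 + 20 s) and LL
n = log log n. The hypothesis serves to make √e_k summable; after that the argument combines a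
conditional second moment bound, an Ottaviani type iteration and an L¹ truncation.

Covariances: a superlevel set of a function in `Mon`, at a level t ≥ 0, is an interval. The
conditional probability given F₀ that Y_k lies in an interval is within 2 e_k of its mean.
Integrating over levels t, and splitting the F₀-measurable weight W at height 2√e_k · t, bounds ∫ W
(g(Y_k) - E g(Y_k)) by √e_k times second moments of W and g(Y_k) (`abs_integral_mul_center_le_sq`).
Averaging over combinations and using stationarity, sums built from a function bounded by T satisfy,
conditionally on F₀, E S_m² ≤ m M²(4 + 20 s) + O(T²) (`setIntegral_partialSum_sq_le`).

Exponential bound: for blocks of length b with T² of order at most b, the conditional variance over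
a block is at most K² b. A move by more than 6K√b within b steps then has conditional probability at
most 1/12, and Q successive such moves within n steps have probability at most 12^(n/b) 6^(-Q)
(`measureReal_inter_manyExits_le`). With b about n / LL n and Q about 2 LL n this is at most (log
n)^(-log 3), summable against 1/n because log 3 > 1, and the threshold reached is 13 K √(n LL n).

Truncation: the levels T_n = c Σ_{k≤n} 1/√(k LL k) are O(√(n / LL n)), hence admissible for these
blocks when c is small. As the weights 1/√(n LL n) are the increments of T_n / c, the weighted sum
of E|g|1_{|g|>T_n} is at most E g² / c. This bound is uniform over finite combinations, so Fatou's
lemma carries it to the L¹ closure (`MonClosure.exists_bounded`), and Markov's inequality pays for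
replacing f by its approximations.

Constants: bounded part and remainder together use 13.5 K, which is at most 3CM as soon as e_0 ≥
1/2. If e_0 < 1/2, then Y₀ is almost surely constant and all sums vanish. -/

/-- The conditional probability of `B` given `F` differs from `P(B)` by at most `δ`, tested against
bounded `F`-measurable weights. -/
def CondDiscrepancyLE (F : MeasurableSpace Ω) [MeasurableSpace Ω] (P : Measure Ω) (B : Set Ω)
    (δ : ℝ) : Prop :=
  ∀ W : Ω → ℝ, Measurable[F] W → (∃ c, ∀ ω, |W ω| ≤ c) →
    |∫ ω, W ω * center P (B.indicator 1) ω ∂P| ≤ δ * ∫ ω, |W ω| ∂P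

/-! ### From distribution functions to intervals. -/

section Basic

variable {F : MeasurableSpace Ω} [mΩ : MeasurableSpace Ω] {P : Measure Ω} [IsProbabilityMeasure P]

lemma integrable_of_bounded {W : Ω → ℝ} (hW : Measurable W) {c : ℝ} (hc : ∀ ω, |W ω| ≤ c) :
    Integrable W P :=
  Integrable.of_bound hW.aestronglyMeasurable c (Filter.Eventually.of_forall hc)

lemma center_indicator {B : Set Ω} (hB : MeasurableSet B) (ω : Ω) :
    center P (B.indicator 1) ω = B.indicator 1 ω - P.real B := by
  simp [center, integral_indicator_one hB]

lemma abs_center_indicator_le {B : Set Ω} (hB : MeasurableSet B) (ω : Ω) :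
    |center P (B.indicator 1) ω| ≤ 1 := by
  rw [center_indicator hB, abs_le]
  have h0 : 0 ≤ P.real B := measureReal_nonneg
  have h1 : P.real B ≤ 1 := measureReal_le_one
  by_cases h : ω ∈ B <;> simp [h] <;> linarith

lemma measurable_center {X : Ω → ℝ} (hX : Measurable X) : Measurable (center P X) :=
  hX.sub_const _

lemma integral_center {X : Ω → ℝ} (hX : Integrable X P) : ∫ ω, center P X ω ∂P = 0 := by
  simp [center, integral_sub hX (integrable_const _)]

/-- An F-measurable weight can be moved inside the conditional expectation, which is bounded by δ
almost surely. The outer centering in `phi` has no effect, since a centered indicator already has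
mean zero. -/
lemma condDiscrepancyLE_of_phi (hF : F ≤ mΩ) {Z : Ω → ℝ}
    (hZ : Measurable Z) {δ : ℝ} (hδ : phi F P (fun _ : Fin 1 => Z) ≤ ENNReal.ofReal δ)
    (hδ0 : 0 ≤ δ) (x : ℝ) : CondDiscrepancyLE F P {ω | Z ω ≤ x} δ := by
  intro W hW ⟨c, hc⟩
  have hB : MeasurableSet {ω | Z ω ≤ x} := hZ measurableSet_Iic
  set R : Ω → ℝ := center P ({ω | Z ω ≤ x}.indicator 1) with hR
  have hRm : Measurable R := measurable_center (measurable_one.indicator hB)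
  have hRb : ∀ ω, |R ω| ≤ 1 := abs_center_indicator_le hB
  have hRi : Integrable R P := integrable_of_bounded hRm hRb
  have h1 : eLpNorm (center P (P[R | F])) ∞ P ≤ ENNReal.ofReal δ := by
    refine le_trans ?_ hδ
    refine le_trans (le_of_eq ?_) (le_iSup _ (fun _ => x))
    simp [hR]
  have h2 : center P (P[R | F]) = P[R | F] := by
    funext ω
    rw [center, integral_condExp hF, integral_center, sub_zero]
    exact integrable_of_bounded (measurable_one.indicator hB) (c := 1) fun ω => by
      by_cases h : ω ∈ {ω | Z ω ≤ x} <;> simp [Set.indicator, h]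
  rw [h2, eLpNorm_exponent_top] at h1
  have h3 : ∀ᵐ ω ∂P, |(P[R | F]) ω| ≤ δ := by
    filter_upwards [ae_le_eLpNormEssSup (f := P[R | F]) (μ := P)] with ω hω
    have := hω.trans h1
    rw [← ofReal_norm, ENNReal.ofReal_le_ofReal_iff hδ0] at this
    exact this
  have hWi : Integrable W P := integrable_of_bounded (hW.mono hF le_rfl) hc
  have h4 : P[W * R | F] =ᵐ[P] W * P[R | F] :=
    condExp_stronglyMeasurable_mul_of_bound hF hW.stronglyMeasurable hRi c
      (Filter.Eventually.of_forall hc)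
  have h5 : ∫ ω, W ω * R ω ∂P = ∫ ω, W ω * (P[R | F]) ω ∂P := by
    have h6 := integral_condExp (μ := P) (f := W * R) hF
    rw [integral_congr_ae h4] at h6
    exact h6.symm
  rw [h5, ← integral_const_mul]
  refine abs_integral_le_integral_abs.trans (integral_mono_ae ?_ (hWi.abs.const_mul δ) ?_)
  · exact (integrable_condExp.bdd_mul hWi.aestronglyMeasurable (c := c)
      (Filter.Eventually.of_forall hc)).abs
  · filter_upwards [h3] with ω hω
    simp only [abs_mul]
    rw [mul_comm]
    exact mul_le_mul_of_nonneg_right hω (abs_nonneg _)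

/-- Dominated convergence; it reaches open rays and the whole line from closed rays without loss. -/
lemma CondDiscrepancyLE.iUnion (hF : F ≤ mΩ) {B : ℕ → Set Ω} (hB : ∀ n, MeasurableSet (B n))
    (hmono : Monotone B) {δ : ℝ} (h : ∀ n, CondDiscrepancyLE F P (B n) δ) :
    CondDiscrepancyLE F P (⋃ n, B n) δ := by
  intro W hW ⟨c, hc⟩
  have hWm : Measurable W := hW.mono hF le_rfl
  refine le_of_tendsto' (x := Filter.atTop) (Filter.Tendsto.abs ?_)
    (fun n => h n W hW ⟨c, hc⟩)
  refine tendsto_integral_of_dominated_convergence (fun _ => c) ?_ (integrable_const c) ?_ ?_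
  · intro n
    exact (hWm.mul (measurable_center (measurable_one.indicator (hB n)))).aestronglyMeasurable
  · intro n
    refine Filter.Eventually.of_forall fun ω => ?_
    rw [Real.norm_eq_abs, abs_mul]
    have := mul_le_mul (hc ω) (abs_center_indicator_le (P := P) (hB n) ω) (abs_nonneg _)
      ((abs_nonneg _).trans (hc ω))
    simpa using this
  · refine Filter.Eventually.of_forall fun ω => ?_
    simp only [center_indicator (hB _), center_indicator (MeasurableSet.iUnion hB)]
    refine (Filter.Tendsto.sub ?_ ?_).const_mul _
    · exact (hmono.tendsto_indicator B (1 : Ω → ℝ) ω).mono_right (pure_le_nhds _)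
    · exact (ENNReal.tendsto_toReal (measure_ne_top _ _)).comp
        (tendsto_measure_iUnion_atTop hmono)

lemma CondDiscrepancyLE.diff (hF : F ≤ mΩ) {U V : Set Ω} (hU : MeasurableSet U)
    (hV : MeasurableSet V) (hVU : V ⊆ U) {δ δ' : ℝ} (h : CondDiscrepancyLE F P U δ)
    (h' : CondDiscrepancyLE F P V δ') : CondDiscrepancyLE F P (U \ V) (δ + δ') := by
  intro W hW ⟨c, hc⟩
  have hWm : Measurable W := hW.mono hF le_rfl
  have hi : ∀ {B : Set Ω}, MeasurableSet B →
      Integrable (fun ω => W ω * center P (B.indicator 1) ω) P := fun {B} hB =>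
    (integrable_of_bounded (measurable_center (measurable_one.indicator hB))
      (abs_center_indicator_le hB)).bdd_mul hWm.aestronglyMeasurable
      (Filter.Eventually.of_forall hc)
  have e : ∀ ω, W ω * center P ((U \ V).indicator 1) ω =
      W ω * center P (U.indicator 1) ω - W ω * center P (V.indicator 1) ω := by
    intro ω
    rw [center_indicator hU, center_indicator hV, center_indicator (hU.diff hV),
      measureReal_sdiff hVU hV]
    have : (U \ V).indicator (1 : Ω → ℝ) ω = U.indicator 1 ω - V.indicator 1 ω := by
      by_cases h1 : ω ∈ V
      · simp [h1, hVU h1]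
      · by_cases h2 : ω ∈ U <;> simp [h1, h2]
    rw [this]
    ring
  simp_rw [e]
  rw [integral_sub (hi hU) (hi hV), add_mul]
  exact (abs_sub _ _).trans (add_le_add (h W hW ⟨c, hc⟩) (h' W hW ⟨c, hc⟩))

lemma CondDiscrepancyLE.empty {δ : ℝ} (hδ : 0 ≤ δ) :
    CondDiscrepancyLE F P (∅ : Set Ω) δ := by
  intro W _ _
  simp only [center_indicator MeasurableSet.empty]
  simpa using mul_nonneg hδ (integral_nonneg fun ω => abs_nonneg (W ω))

/-- A lower set of ℝ is empty, a closed ray, or an increasing union of closed rays. -/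
lemma CondDiscrepancyLE.preimage_lowerSet (hF : F ≤ mΩ) {Z : Ω → ℝ} (hZ : Measurable Z) {δ : ℝ}
    (hδ : 0 ≤ δ) (h : ∀ x, CondDiscrepancyLE F P {ω | Z ω ≤ x} δ) {s : Set ℝ}
    (hs : IsLowerSet s) : CondDiscrepancyLE F P (Z ⁻¹' s) δ := by
  have hm : ∀ x, MeasurableSet {ω | Z ω ≤ x} := fun x => hZ measurableSet_Iic
  rcases s.eq_empty_or_nonempty with rfl | hne
  · simpa using CondDiscrepancyLE.empty hδ
  by_cases hbdd : BddAbove s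
  · by_cases hx : sSup s ∈ s
    · have : s = Set.Iic (sSup s) :=
        Set.Subset.antisymm (fun y hy => le_csSup hbdd hy) (fun y hy => hs hy hx)
      rw [this]; exact h _
    · have : Z ⁻¹' s = ⋃ n : ℕ, {ω | Z ω ≤ sSup s - 1 / ((n : ℝ) + 1)} := by
        ext ω
        simp only [Set.mem_preimage, Set.mem_iUnion, Set.mem_ofPred_eq]
        constructor
        · intro hω
          have hlt : Z ω < sSup s :=
            lt_of_le_of_ne (le_csSup hbdd hω) fun h => hx (h ▸ hω)
          obtain ⟨n, hn⟩ := exists_nat_one_div_lt (sub_pos.2 hlt)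
          exact ⟨n, by linarith⟩
        · rintro ⟨n, hn⟩
          have hp : (0 : ℝ) < 1 / ((n : ℝ) + 1) := by positivity
          obtain ⟨y, hy, hy'⟩ := exists_lt_of_lt_csSup hne (show Z ω < sSup s by linarith)
          exact hs hy'.le hy
      rw [this]
      refine CondDiscrepancyLE.iUnion hF (fun n => hm _) ?_ fun n => h _
      intro m n hmn ω hω
      simp only [Set.mem_ofPred_eq] at hω ⊢
      have : 1 / ((n : ℝ) + 1) ≤ 1 / ((m : ℝ) + 1) := by gcongr
      linarith
  · have : Z ⁻¹' s = ⋃ n : ℕ, {ω | Z ω ≤ n} := by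
      ext ω
      simp only [Set.mem_preimage, Set.mem_iUnion, Set.mem_ofPred_eq]
      refine ⟨fun _ => exists_nat_ge _, fun _ => ?_⟩
      obtain ⟨y, hy, hy'⟩ := not_bddAbove_iff.1 hbdd (Z ω)
      exact hs hy'.le hy
    rw [this]
    refine CondDiscrepancyLE.iUnion hF (fun n => hm _) ?_ fun n => h _
    intro m n hmn ω hω
    simp only [Set.mem_ofPred_eq] at hω ⊢
    exact hω.trans (by exact_mod_cast hmn)

/-- An interval is a difference of two nested lower sets, its downward closure and the points
strictly below it; each costs δ. -/
lemma CondDiscrepancyLE.preimage_ordConnected (hF : F ≤ mΩ) {Z : Ω → ℝ} (hZ : Measurable Z)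
    {δ : ℝ} (hδ : 0 ≤ δ) (h : ∀ x, CondDiscrepancyLE F P {ω | Z ω ≤ x} δ) {s : Set ℝ}
    (hs : s.OrdConnected) : CondDiscrepancyLE F P (Z ⁻¹' s) (2 * δ) := by
  have hU : IsLowerSet {x | ∃ y ∈ s, x ≤ y} := fun a b hab ⟨y, hy, hay⟩ => ⟨y, hy, hab.trans hay⟩
  have hV : IsLowerSet {x | (∃ y ∈ s, x ≤ y) ∧ ∀ y ∈ s, x < y} :=
    fun a b hab ⟨⟨y, hy, hay⟩, h⟩ => ⟨⟨y, hy, hab.trans hay⟩, fun y hy => hab.trans_lt (h y hy)⟩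
  have e : s = {x | ∃ y ∈ s, x ≤ y} \ {x | (∃ y ∈ s, x ≤ y) ∧ ∀ y ∈ s, x < y} := by
    ext x
    constructor
    · exact fun hx => ⟨⟨x, hx, le_rfl⟩, fun h => lt_irrefl _ (h.2 x hx)⟩
    · rintro ⟨⟨y, hy, hxy⟩, h⟩
      simp only [Set.mem_ofPred_eq, not_and, not_forall, not_lt] at h
      obtain ⟨z, hz, hzx⟩ := h ⟨y, hy, hxy⟩
      exact hs.out hz hy ⟨hzx, hxy⟩
  rw [e, Set.preimage_sdiff, two_mul]
  exact CondDiscrepancyLE.diff hF (hZ hU.ordConnected.measurableSet)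
    (hZ hV.ordConnected.measurableSet) (Set.preimage_mono fun x hx => hx.1)
    (preimage_lowerSet hF hZ hδ h hU) (preimage_lowerSet hF hZ hδ h hV)

end Basic

variable {Ω : Type*}

/-! ### Covariance inequalities by integration over levels. -/

section LayerCake

variable {F : MeasurableSpace Ω} [mΩ : MeasurableSpace Ω] {P : Measure Ω} [IsProbabilityMeasure P]

lemma setIntegral_Ioc_indicator_lt_mul_pow {c T : ℝ} (hc : 0 ≤ c) (hT : 0 ≤ T) (j : ℕ) :
    ∫ t in Set.Ioc 0 T, (if t < c then 1 else 0) * t ^ j = min c T ^ (j + 1) / (j + 1) := by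
  have h1 : ∀ᵐ t ∂(volume.restrict (Set.Ioc 0 T)), (if t < c then 1 else 0) * t ^ j =
      (Set.Ioc 0 (min c T)).indicator (fun t => t ^ j) t := by
    have h2 : ∀ᵐ t ∂(volume.restrict (Set.Ioc 0 T)), t ≠ c :=
      ae_restrict_of_ae (Measure.ae_ne volume c)
    filter_upwards [h2, ae_restrict_mem measurableSet_Ioc] with t ht htm
    by_cases h : t < c
    · have : t ∈ Set.Ioc 0 (min c T) := ⟨htm.1, le_min h.le htm.2⟩
      simp [h, this]
    · have : t ∉ Set.Ioc 0 (min c T) := fun h' =>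
        h (lt_of_le_of_ne (h'.2.trans (min_le_left _ _)) ht)
      simp [h, this]
  rw [integral_congr_ae h1, setIntegral_indicator measurableSet_Ioc,
    Set.inter_eq_right.2 (Set.Ioc_subset_Ioc_right (min_le_right c T)),
    ← intervalIntegral.integral_of_le (le_min hc hT), integral_pow]
  simp

lemma integrable_prod_layer {V U : Ω → ℝ} (hV : Measurable V) {c : ℝ} (hc : ∀ ω, |V ω| ≤ c)
    (hU : Measurable U) (T : ℝ) (j : ℕ) :
    Integrable (Function.uncurry fun (t : ℝ) (ω : Ω) =>
      V ω * ((if t < U ω then 1 else 0) * t ^ j)) ((volume.restrict (Set.Ioc 0 T)).prod P) := by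
  have hm : Measurable (Function.uncurry fun (t : ℝ) (ω : Ω) =>
      V ω * ((if t < U ω then 1 else 0) * t ^ j)) := by
    refine (hV.comp measurable_snd).mul (Measurable.mul ?_ (measurable_fst.pow_const j))
    exact Measurable.ite (measurableSet_lt measurable_fst (hU.comp measurable_snd))
      measurable_const measurable_const
  refine Integrable.of_bound hm.aestronglyMeasurable (c * T ^ j) ?_
  have h1 : ∀ᵐ p ∂((volume.restrict (Set.Ioc 0 T)).prod P), p.1 ∈ Set.Ioc 0 T :=
    Measure.quasiMeasurePreserving_fst.ae (ae_restrict_mem measurableSet_Ioc)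
  filter_upwards [h1] with p hp
  simp only [Function.uncurry, Real.norm_eq_abs, abs_mul, abs_pow, abs_of_pos hp.1]
  have hc0 : 0 ≤ c := (abs_nonneg _).trans (hc p.2)
  refine mul_le_mul (hc _) ?_ (mul_nonneg (abs_nonneg _) (pow_nonneg hp.1.le j)) hc0
  have h2 : p.1 ^ j ≤ T ^ j := pow_le_pow_left₀ hp.1.le hp.2 j
  have h3 : 0 ≤ p.1 ^ j := pow_nonneg hp.1.le j
  split_ifs <;> simp <;> linarith

lemma setIntegral_layer {V U : Ω → ℝ} (hV : Measurable V) {c : ℝ} (hc : ∀ ω, |V ω| ≤ c)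
    (hU : Measurable U) (hU0 : ∀ ω, 0 ≤ U ω) {T : ℝ} (hT : 0 ≤ T) (j : ℕ) :
    ∫ t in Set.Ioc 0 T, ∫ ω, V ω * ((if t < U ω then 1 else 0) * t ^ j) ∂P =
      ∫ ω, V ω * (min (U ω) T ^ (j + 1) / (j + 1)) ∂P := by
  rw [integral_integral_swap (integrable_prod_layer hV hc hU T j)]
  refine integral_congr_ae (Filter.Eventually.of_forall fun ω => ?_)
  simp only
  rw [integral_const_mul, setIntegral_Ioc_indicator_lt_mul_pow (hU0 ω) hT]

lemma integrableOn_layer {V U : Ω → ℝ} (hV : Measurable V) {c : ℝ} (hc : ∀ ω, |V ω| ≤ c)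
    (hU : Measurable U) (T : ℝ) (j : ℕ) :
    IntegrableOn (fun t => ∫ ω, V ω * ((if t < U ω then 1 else 0) * t ^ j) ∂P) (Set.Ioc 0 T) :=
  (integrable_prod_layer hV hc hU T j).integral_prod_left

/-- U is the integral over t of the indicators of {t < U}, and centering is linear. -/
lemma integral_mul_center_eq_layer {W U : Ω → ℝ} (hW : Measurable W) {c : ℝ}
    (hc : ∀ ω, |W ω| ≤ c) (hU : Measurable U) (hU0 : ∀ ω, 0 ≤ U ω) {T : ℝ}
    (hUT : ∀ ω, U ω ≤ T) (hT : 0 ≤ T) :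
    ∫ ω, W ω * center P U ω ∂P =
      ∫ t in Set.Ioc 0 T, ∫ ω, W ω * center P ({ω | t < U ω}.indicator 1) ω ∂P := by
  have hUi : Integrable U P := integrable_of_bounded hU (c := T)
    fun ω => by rw [abs_of_nonneg (hU0 ω)]; exact hUT ω
  have hWi : Integrable W P := integrable_of_bounded hW hc
  have hWU : Integrable (fun ω => W ω * U ω) P :=
    hUi.bdd_mul hW.aestronglyMeasurable (Filter.Eventually.of_forall hc)
  have e1 : ∫ ω, W ω * U ω ∂P =
      ∫ t in Set.Ioc 0 T, ∫ ω, W ω * ((if t < U ω then 1 else 0) * t ^ 0) ∂P := by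
    rw [setIntegral_layer hW hc hU hU0 hT]
    simp [min_eq_left (hUT _)]
  have e2 : ∫ ω, U ω ∂P =
      ∫ t in Set.Ioc 0 T, ∫ ω, (1 : ℝ) * ((if t < U ω then 1 else 0) * t ^ 0) ∂P := by
    rw [setIntegral_layer measurable_const (c := 1) (by simp) hU hU0 hT]
    simp [min_eq_left (hUT _)]
  have e3 : ∀ t, ∫ ω, W ω * center P ({ω | t < U ω}.indicator 1) ω ∂P =
      (∫ ω, W ω * ((if t < U ω then 1 else 0) * t ^ 0) ∂P) -
      (∫ ω, W ω ∂P) * ∫ ω, (1 : ℝ) * ((if t < U ω then 1 else 0) * t ^ 0) ∂P := by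
    intro t
    have hB : MeasurableSet {ω | t < U ω} := measurableSet_lt measurable_const hU
    have h4 : ∫ ω, (1 : ℝ) * ((if t < U ω then 1 else 0) * t ^ 0) ∂P = P.real {ω | t < U ω} := by
      rw [← integral_indicator_one hB]
      simp [Set.indicator]
    have h5 : Integrable (fun ω => W ω * ((if t < U ω then 1 else 0) * t ^ 0)) P := by
      refine Integrable.bdd_mul ?_ hW.aestronglyMeasurable (Filter.Eventually.of_forall hc)
      refine integrable_of_bounded (c := 1) ((Measurable.ite hB measurable_const
        measurable_const).mul measurable_const) fun ω => ?_
      split_ifs <;> simp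
    rw [h4, ← integral_mul_const, ← integral_sub h5 (hWi.mul_const _)]
    refine integral_congr_ae (Filter.Eventually.of_forall fun ω => ?_)
    simp only [center_indicator hB, Set.indicator, Set.mem_ofPred_eq, Pi.one_apply]
    ring
  simp_rw [e3]
  rw [integral_sub (integrableOn_layer hW hc hU T 0)
    ((integrableOn_layer measurable_const (c := 1) (by simp) hU T 0).const_mul _),
    integral_const_mul, ← e1, ← e2, ← integral_mul_const, ← integral_sub hWU (hWi.mul_const _)]
  refine integral_congr_ae (Filter.Eventually.of_forall fun ω => ?_)
  simp only [center]
  ring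

/-- The crude bound, in which the sup norm T of U appears. It is later applied to squares, where the
resulting T² is harmless. -/
lemma abs_integral_mul_center_le (hF : F ≤ mΩ) {W U : Ω → ℝ} (hW : Measurable[F] W) {c : ℝ}
    (hc : ∀ ω, |W ω| ≤ c) (hU : Measurable U) (hU0 : ∀ ω, 0 ≤ U ω) {T : ℝ}
    (hUT : ∀ ω, U ω ≤ T) (hT : 0 ≤ T) {δ : ℝ}
    (h : ∀ t, 0 ≤ t → CondDiscrepancyLE F P {ω | t < U ω} δ) :
    |∫ ω, W ω * center P U ω ∂P| ≤ δ * T * ∫ ω, |W ω| ∂P := by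
  rw [integral_mul_center_eq_layer (hW.mono hF le_rfl) hc hU hU0 hUT hT, ← Real.norm_eq_abs]
  refine (norm_setIntegral_le_of_norm_le_const (C := δ * ∫ ω, |W ω| ∂P) (by simp)
    fun t ht => h t ht.1.le W hW ⟨c, hc⟩).trans (le_of_eq ?_)
  simp [hT]
  ring

/-- The essential covariance bound: it costs √δ but involves only second moments, not T. At level t,
mixing handles the part of W above ρt, and the trivial bound |1_B - P(B)| ≤ 1_B + P(B) handles the
part below. The set A localizes the estimate, so that it can be used conditionally. -/
lemma abs_integral_mul_center_le_sq (hF : F ≤ mΩ) {W U : Ω → ℝ} (hW : Measurable[F] W) {c : ℝ}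
    (hc : ∀ ω, |W ω| ≤ c) (hU : Measurable U) (hU0 : ∀ ω, 0 ≤ U ω) {T : ℝ}
    (hUT : ∀ ω, U ω ≤ T) (hT : 0 ≤ T) {δ : ℝ} (hδ : 0 ≤ δ) {A : Set Ω} (hA : MeasurableSet A)
    (hWA : ∀ ω ∉ A, W ω = 0)
    (h : ∀ t, 0 ≤ t → CondDiscrepancyLE F P {ω | t < U ω} (2 * δ)) :
    |∫ ω, W ω * center P U ω ∂P| ≤ √δ * (∫ ω, W ω ^ 2 ∂P + ∫ ω in A, U ω ^ 2 ∂P +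
      P.real A * ∫ ω, U ω ^ 2 ∂P) := by
  have hWm : Measurable W := hW.mono hF le_rfl
  have hWi : Integrable W P := integrable_of_bounded hWm hc
  rcases hδ.eq_or_lt with rfl | hδ'
  · simpa using abs_integral_mul_center_le hF hW hc hU hU0 hUT hT h
  -- This choice balances the two parts: after integration in t the first has factor 2δ/ρ and the
  -- second ρ/2, both equal to √δ.
  set ρ : ℝ := 2 * √δ with hρ
  have hρ0 : 0 < ρ := by positivity
  have hsq : √δ * √δ = δ := Real.mul_self_sqrt hδ
  rw [integral_mul_center_eq_layer hWm hc hU hU0 hUT hT, ← Real.norm_eq_abs]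
  have hVm : Measurable (fun ω => A.indicator (1 : Ω → ℝ) ω + P.real A) :=
    (measurable_one.indicator hA).add_const _
  have hVb : ∀ ω, |A.indicator (1 : Ω → ℝ) ω + P.real A| ≤ 2 := fun ω => by
    have h1 : P.real A ≤ 1 := measureReal_le_one
    have h0 : 0 ≤ P.real A := measureReal_nonneg
    by_cases hω : ω ∈ A
    · simp only [hω, Set.indicator_of_mem, Pi.one_apply]; rw [abs_of_nonneg] <;> linarith
    · simp only [hω, not_false_eq_true, Set.indicator_of_notMem]; rw [abs_of_nonneg] <;> linarith
  have hWa : Measurable fun ω => |W ω| := hWm.abs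
  have hWac : ∀ ω, |(|W ω|)| ≤ c := fun ω => by rw [abs_abs]; exact hc ω
  have hWρ : Measurable fun ω => |W ω| / ρ := hWa.div_const _
  have hint := ((integrableOn_layer (P := P) hWa hWac hWρ T 0).const_mul (2 * δ)).add
    ((integrableOn_layer (P := P) hVm hVb hU T 1).const_mul ρ)
  refine (norm_integral_le_of_norm_le hint ?_).trans ?_
  · filter_upwards [ae_restrict_mem measurableSet_Ioc] with t ht
    simp only [Pi.add_apply]
    set B : Set Ω := {ω | t < U ω} with hBdef
    have hB : MeasurableSet B := measurableSet_lt measurable_const hU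
    set D : Set Ω := {ω | t < |W ω| / ρ} with hD
    have hDF : MeasurableSet[F] D :=
      ((measurable_id.abs.div_const ρ : Measurable fun x : ℝ => |x| / ρ).comp hW) measurableSet_Ioi
    have hDm : MeasurableSet D := hF _ hDF
    have hR := measurable_center (P := P)
      (show Measurable (B.indicator (1 : Ω → ℝ)) from measurable_one.indicator hB)
    have hRb := abs_center_indicator_le (P := P) hB
    have hRi : Integrable (center P (B.indicator (1 : Ω → ℝ))) P := integrable_of_bounded hR hRb
    have hW1 : Measurable[F] (D.indicator W) := hW.indicator hDF
    have hW1b : ∀ ω, |D.indicator W ω| ≤ c := fun ω => by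
      by_cases hω : ω ∈ D
      · simp [hω, hc]
      · simpa [hω] using (abs_nonneg _).trans (hc ω)
    have hW2b : ∀ ω, |Dᶜ.indicator W ω| ≤ c := fun ω => by
      by_cases hω : ω ∈ D
      · simpa [hω] using (abs_nonneg _).trans (hc ω)
      · simp [hω, hc]
    have hi1 : Integrable (fun ω => D.indicator W ω * center P (B.indicator 1) ω) P :=
      hRi.bdd_mul (hWm.indicator hDm).aestronglyMeasurable (Filter.Eventually.of_forall hW1b)
    have hi2 : Integrable (fun ω => Dᶜ.indicator W ω * center P (B.indicator 1) ω) P :=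
      hRi.bdd_mul (hWm.indicator hDm.compl).aestronglyMeasurable
        (Filter.Eventually.of_forall hW2b)
    have hsplit : ∫ ω, W ω * center P (B.indicator 1) ω ∂P =
        (∫ ω, D.indicator W ω * center P (B.indicator 1) ω ∂P) +
        ∫ ω, Dᶜ.indicator W ω * center P (B.indicator 1) ω ∂P := by
      rw [← integral_add hi1 hi2]
      refine integral_congr_ae (Filter.Eventually.of_forall fun ω => ?_)
      simp only
      rw [← add_mul, Set.indicator_self_add_compl_apply]
    rw [hsplit]
    refine (norm_add_le _ _).trans (add_le_add ?_ ?_)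
    · refine (h t ht.1.le _ hW1 ⟨c, hW1b⟩).trans (le_of_eq ?_)
      congr 1
      refine integral_congr_ae (Filter.Eventually.of_forall fun ω => ?_)
      by_cases hω : t < |W ω| / ρ <;> simp [hD, Set.indicator, hω]
    · have hVi : Integrable (fun ω => (A.indicator (1 : Ω → ℝ) ω + P.real A) *
          B.indicator 1 ω) P := by
        refine ((integrable_const (1 : ℝ)).indicator hB).bdd_mul hVm.aestronglyMeasurable
          (Filter.Eventually.of_forall hVb)
      have hAi : Integrable (A.indicator (1 : Ω → ℝ)) P := (integrable_const (1 : ℝ)).indicator hA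
      have hABi : Integrable (fun ω => A.indicator (1 : Ω → ℝ) ω * B.indicator 1 ω) P :=
        ((integrable_const (1 : ℝ)).indicator hB).bdd_mul
          (measurable_one.indicator hA).aestronglyMeasurable (c := 1)
          (Filter.Eventually.of_forall fun ω => by by_cases hω : ω ∈ A <;> simp [hω])
      have hBi : Integrable (B.indicator (1 : Ω → ℝ)) P := (integrable_const (1 : ℝ)).indicator hB
      -- The roles of A and B are exchanged, since E[1_A (1_B + P(B))] = E[(1_A + P(A)) 1_B]; the
      -- level t then enters only through B, and integrating it produces U²/2.
      have e1 : ∫ ω, (A.indicator (1 : Ω → ℝ) ω + P.real A) *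
          ((if t < U ω then 1 else 0) * t ^ 1) ∂P =
          t * ∫ ω, A.indicator (1 : Ω → ℝ) ω * (B.indicator 1 ω + P.real B) ∂P := by
        have e2 : ∫ ω, A.indicator (1 : Ω → ℝ) ω * (B.indicator 1 ω + P.real B) ∂P =
            ∫ ω, (A.indicator (1 : Ω → ℝ) ω + P.real A) * B.indicator 1 ω ∂P := by
          simp_rw [mul_add, add_mul]
          rw [integral_add hABi (hAi.mul_const _), integral_add hABi (hBi.const_mul _),
            integral_mul_const, integral_const_mul, integral_indicator_one hA,
            integral_indicator_one hB]
        rw [e2, ← integral_const_mul]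
        refine integral_congr_ae (Filter.Eventually.of_forall fun ω => ?_)
        simp only [hBdef, Set.indicator, Set.mem_ofPred_eq, Pi.one_apply]
        ring
      rw [e1, ← mul_assoc, ← integral_const_mul]
      refine norm_integral_le_of_norm_le ?_ (Filter.Eventually.of_forall fun ω => ?_)
      · refine Integrable.const_mul ?_ _
        simp_rw [mul_add]
        exact hABi.add (hAi.mul_const _)
      · rw [norm_mul, Real.norm_eq_abs, Real.norm_eq_abs]
        have hb0 : 0 ≤ P.real B := measureReal_nonneg
        have hcb : |center P (B.indicator 1) ω| ≤ B.indicator 1 ω + P.real B := by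
          rw [center_indicator hB]
          refine (abs_sub _ _).trans (le_of_eq ?_)
          rw [abs_of_nonneg hb0, abs_of_nonneg (Set.indicator_nonneg (by simp) _)]
        have hpos : 0 ≤ B.indicator (1 : Ω → ℝ) ω + P.real B := (abs_nonneg _).trans hcb
        rw [← mul_assoc]
        refine mul_le_mul ?_ hcb (abs_nonneg _) ?_
        · by_cases hωA : ω ∈ A
          · by_cases hω : ω ∈ D
            · simp only [Set.mem_compl_iff, hω, not_true_eq_false, not_false_eq_true,
                Set.indicator_of_notMem, abs_zero, hωA, Set.indicator_of_mem, Pi.one_apply]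
              have := ht.1
              positivity
            · simp only [Set.mem_compl_iff, hω, not_false_eq_true, Set.indicator_of_mem, hωA,
                Pi.one_apply, mul_one]
              have : ¬ t < |W ω| / ρ := hω
              rw [not_lt, div_le_iff₀ hρ0] at this
              linarith
          · simp [hωA, hWA ω hωA, Set.indicator]
        · have := ht.1
          have h3 : 0 ≤ A.indicator (1 : Ω → ℝ) ω := Set.indicator_nonneg (by simp) _
          positivity
  · simp only [Pi.add_apply]
    have hint1 := ((integrableOn_layer (P := P) hWa hWac hWρ T 0).const_mul (2 * δ))
    have hint2 := ((integrableOn_layer (P := P) hVm hVb hU T 1).const_mul ρ)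
    rw [integral_add hint1 hint2, integral_const_mul, integral_const_mul,
      setIntegral_layer hWa hWac hWρ (fun ω => by positivity) hT,
      setIntegral_layer hVm hVb hU hU0 hT]
    have hU2m : Measurable fun ω => U ω ^ 2 := hU.pow_const 2
    have hU2i : Integrable (fun ω => U ω ^ 2) P :=
      integrable_of_bounded hU2m (c := T ^ 2) fun ω => by
        rw [abs_of_nonneg (sq_nonneg _)]; exact pow_le_pow_left₀ (hU0 ω) (hUT ω) 2
    have hW2i : Integrable (fun ω => W ω ^ 2) P :=
      integrable_of_bounded (hWm.pow_const 2) (c := c ^ 2) fun ω => by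
        rw [abs_pow]; exact pow_le_pow_left₀ (abs_nonneg _) (hc ω) 2
    have b1 : ∫ ω, |W ω| * (min (|W ω| / ρ) T ^ (0 + 1) / ((0 : ℕ) + 1)) ∂P ≤
        ∫ ω, W ω ^ 2 / ρ ∂P := by
      refine integral_mono_of_nonneg (Filter.Eventually.of_forall fun ω => ?_)
        (hW2i.div_const _) (Filter.Eventually.of_forall fun ω => ?_)
      · have : 0 ≤ min (|W ω| / ρ) T := le_min (by positivity) hT
        simp only [Pi.zero_apply]
        positivity
      · simp only [zero_add, pow_one, Nat.cast_zero, div_one]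
        calc |W ω| * min (|W ω| / ρ) T ≤ |W ω| * (|W ω| / ρ) :=
              mul_le_mul_of_nonneg_left (min_le_left _ _) (abs_nonneg _)
          _ = W ω ^ 2 / ρ := by rw [← sq_abs]; ring
    have b2 : ∫ ω, (A.indicator (1 : Ω → ℝ) ω + P.real A) *
        (min (U ω) T ^ (1 + 1) / ((1 : ℕ) + 1)) ∂P =
        (∫ ω in A, U ω ^ 2 ∂P + P.real A * ∫ ω, U ω ^ 2 ∂P) / 2 := by
      rw [← integral_indicator hA, ← integral_const_mul,
        ← integral_add (hU2i.indicator hA) (hU2i.const_mul _), ← integral_div]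
      refine integral_congr_ae (Filter.Eventually.of_forall fun ω => ?_)
      simp only [min_eq_left (hUT ω)]
      by_cases hω : ω ∈ A <;> simp [hω] <;> ring
    rw [b2]
    rw [integral_div] at b1
    have b3 : 2 * δ * ((∫ ω, W ω ^ 2 ∂P) / ρ) = √δ * ∫ ω, W ω ^ 2 ∂P := by
      have : √δ ≠ 0 := by positivity
      rw [hρ]
      field_simp
      rw [sq, hsq, mul_comm]
    have b4 := mul_le_mul_of_nonneg_left b1 (show 0 ≤ 2 * δ by positivity)
    rw [b3] at b4
    refine (add_le_add_left b4 _).trans (le_of_eq ?_)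
    rw [hρ]
    ring

end LayerCake

/-! ### Functions monotonic on an interval. -/

section MonFunctions

variable {p M : ℝ} {μ : Measure ℝ} {g : ℝ → ℝ}

lemma Mon.neg_mem (hg : g ∈ Mon p M μ) : -g ∈ Mon p M μ := by
  obtain ⟨⟨I, hI, hmon, h0⟩, hint⟩ := hg
  refine ⟨⟨I, hI, hmon.symm.imp (fun h => h.neg) (fun h => h.neg), fun x hx => by
    simp [h0 x hx]⟩, by simpa using hint⟩

/-- Since t ≥ 0, the level is exceeded only inside I, where monotonicity makes the set convex. For t
< 0 this can fail, hence the later split into positive and negative parts. -/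
lemma Mon.ordConnected_superlevel (hg : g ∈ Mon p M μ) {t : ℝ} (ht : 0 ≤ t) :
    {x | t < g x}.OrdConnected := by
  obtain ⟨⟨I, hI, hmon, h0⟩, -⟩ := hg
  have hmem : ∀ {x}, t < g x → x ∈ I := fun {x} hx => by
    by_contra h
    rw [h0 x h] at hx
    linarith
  refine ⟨fun x hx z hz y hy => ?_⟩
  simp only [Set.mem_ofPred_eq] at hx hz ⊢
  have hyI := hI.out (hmem hx) (hmem hz) hy
  rcases hmon with h | h
  · exact hx.trans_le (h (hmem hx) hyI hy.1)
  · exact hz.trans_le (h hyI (hmem hz) hy.2)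

lemma Mon.measurable (hg : g ∈ Mon p M μ) : Measurable g := by
  refine measurable_of_Ioi fun t => ?_
  rcases le_or_gt 0 t with ht | ht
  · exact (Mon.ordConnected_superlevel hg ht).measurableSet
  · obtain ⟨⟨I, hI, hmon, h0⟩, -⟩ := hg
    have h1 : {x | g x ≤ t}.OrdConnected := by
      have hmem : ∀ {x}, g x ≤ t → x ∈ I := fun {x} hx => by
        by_contra h
        rw [h0 x h] at hx
        linarith
      refine ⟨fun x hx z hz y hy => ?_⟩
      simp only [Set.mem_ofPred_eq] at hx hz ⊢
      have hyI := hI.out (hmem hx) (hmem hz) hy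
      rcases hmon with h | h
      · exact (h hyI (hmem hz) hy.2).trans hz
      · exact (h (hmem hx) hyI hy.1).trans hx
    have : g ⁻¹' Set.Ioi t = {x | g x ≤ t}ᶜ := by
      ext x; simp
    rw [this]
    exact h1.measurableSet.compl

/-- `g` cut to zero where `|g| > T`. -/
noncomputable def truncate (T : ℝ) (g : ℝ → ℝ) : ℝ → ℝ :=
  fun x => if |g x| ≤ T then g x else 0

lemma abs_truncate_le {T : ℝ} (hT : 0 ≤ T) (g : ℝ → ℝ) (x : ℝ) : |truncate T g x| ≤ T := by
  unfold truncate
  split_ifs with h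
  · exact h
  · simpa using hT

/-- By monotonicity {|g| ≤ T} cuts I in an interval, so the truncated function stays in the same
class with the same M. -/
lemma Mon.truncate_mem (hp : 0 < p) (hg : g ∈ Mon p M μ) (T : ℝ) : truncate T g ∈ Mon p M μ := by
  obtain ⟨⟨I, hI, hmon, h0⟩, hint⟩ := hg
  refine ⟨⟨{x | x ∈ I ∧ |g x| ≤ T}, ?_, ?_, ?_⟩, le_trans (lintegral_mono fun x => ?_) hint⟩
  · refine ⟨fun x hx z hz y hy => ?_⟩
    have hyI := hI.out hx.1 hz.1 hy
    refine ⟨hyI, ?_⟩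
    have h1 := abs_le.1 hx.2
    have h2 := abs_le.1 hz.2
    rw [abs_le]
    rcases hmon with h | h
    · exact ⟨h1.1.trans (h hx.1 hyI hy.1), (h hyI hz.1 hy.2).trans h2.2⟩
    · exact ⟨h2.1.trans (h hyI hz.1 hy.2), (h hx.1 hyI hy.1).trans h1.2⟩
  · refine hmon.imp (fun h x hx y hy hxy => ?_) (fun h x hx y hy hxy => ?_) <;>
    · simp only [truncate, hx.2, hy.2, if_true]
      exact h hx.1 hy.1 hxy
  · intro x hx
    unfold truncate
    split_ifs with h
    · exact h0 x fun hI => hx ⟨hI, h⟩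
    · rfl
  · refine ENNReal.ofReal_le_ofReal (Real.rpow_le_rpow (abs_nonneg _) ?_ hp.le)
    unfold truncate
    split_ifs with h
    · rfl
    · simp

lemma Mon.integral_sq_le [IsFiniteMeasure μ] (hg : g ∈ Mon 2 M μ) : ∫ x, g x ^ 2 ∂μ ≤ M ^ 2 := by
  have h := hg.2
  simp only [Real.rpow_ofNat, sq_abs] at h
  rw [integral_eq_lintegral_of_nonneg_ae (Filter.Eventually.of_forall fun x => sq_nonneg _)
    ((Mon.measurable hg).pow_const 2).aestronglyMeasurable]
  exact ENNReal.toReal_le_of_le_ofReal (sq_nonneg _) h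

/-- `h = ∑ a_l g_l` and `G = ∑ |a_l| g_l²` where `∑ |a_l| ≤ 1` and the `g_l ∈ Mon_2(M, μ)` are
bounded by `T`. -/
def IsBoundedMonComb (M T : ℝ) (μ : Measure ℝ) (h G : ℝ → ℝ) : Prop :=
  ∃ (L : ℕ) (a : Fin L → ℝ) (g : Fin L → ℝ → ℝ), (∀ l, g l ∈ Mon 2 M μ) ∧ (∀ l x, |g l x| ≤ T) ∧
    ∑ l, |a l| ≤ 1 ∧ h = (fun x => ∑ l, a l * g l x) ∧ G = fun x => ∑ l, |a l| * g l x ^ 2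

end MonFunctions

/-! ### Conditional estimates for one monotonic piece. -/

section SingleFunction

variable {Ω : Type*} {F : MeasurableSpace Ω} [mΩ : MeasurableSpace Ω] {P : Measure Ω}
  [IsProbabilityMeasure P] {M T : ℝ} {μ : Measure ℝ} {g : ℝ → ℝ} {Z : Ω → ℝ} {δ : ℝ}

lemma Mon.condDiscrepancyLE (hF : F ≤ mΩ) (hZ : Measurable Z) (hδ : 0 ≤ δ)
    (hZF : ∀ x, CondDiscrepancyLE F P {ω | Z ω ≤ x} δ) (hg : g ∈ Mon 2 M μ) {t : ℝ} (ht : 0 ≤ t) :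
    CondDiscrepancyLE F P {ω | t < max (g (Z ω)) 0} (2 * δ) := by
  have := CondDiscrepancyLE.preimage_ordConnected hF hZ hδ hZF (Mon.ordConnected_superlevel hg ht)
  convert this using 1
  ext ω
  simp [ht]

lemma Mon.condDiscrepancyLE_sq (hF : F ≤ mΩ) (hZ : Measurable Z) (hδ : 0 ≤ δ)
    (hZF : ∀ x, CondDiscrepancyLE F P {ω | Z ω ≤ x} δ) (hg : g ∈ Mon 2 M μ) {t : ℝ} (ht : 0 ≤ t) :
    CondDiscrepancyLE F P {ω | t < max (g (Z ω)) 0 ^ 2} (2 * δ) := by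
  have := Mon.condDiscrepancyLE hF hZ hδ hZF hg (Real.sqrt_nonneg t)
  convert this using 1
  ext ω
  simp only [Set.mem_ofPred_eq]
  constructor
  · intro h
    have := Real.sqrt_lt_sqrt ht h
    rwa [Real.sqrt_sq (le_max_right _ _)] at this
  · exact fun h => Real.lt_sq_of_sqrt_lt h

/-- The crude layer bound with weight 1_A: conditionally on F the second moment is the unconditional
one up to 2δT². -/
lemma Mon.setIntegral_max_sq_le (hF : F ≤ mΩ) (hZ : Measurable Z) (hδ : 0 ≤ δ)
    (hZF : ∀ x, CondDiscrepancyLE F P {ω | Z ω ≤ x} δ) (hg : g ∈ Mon 2 M μ)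
    (hgT : ∀ x, |g x| ≤ T) (hT : 0 ≤ T) {A : Set Ω} (hA : MeasurableSet[F] A) :
    ∫ ω in A, max (g (Z ω)) 0 ^ 2 ∂P ≤
      P.real A * (∫ ω, max (g (Z ω)) 0 ^ 2 ∂P + 2 * δ * T ^ 2) := by
  have hAm := hF _ hA
  have hm : Measurable fun ω => max (g (Z ω)) 0 ^ 2 :=
    (((Mon.measurable hg).comp hZ).max measurable_const).pow_const 2
  have hb : ∀ ω, max (g (Z ω)) 0 ^ 2 ≤ T ^ 2 := fun ω =>
    pow_le_pow_left₀ (le_max_right _ _) (max_le ((le_abs_self _).trans (hgT _)) hT) 2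
  have hi : Integrable (fun ω => max (g (Z ω)) 0 ^ 2) P :=
    integrable_of_bounded hm fun ω => by rw [abs_of_nonneg (sq_nonneg _)]; exact hb ω
  have hAb : ∀ ω, |A.indicator (1 : Ω → ℝ) ω| ≤ 1 := fun ω => by
    by_cases h : ω ∈ A <;> simp [h]
  have key := abs_integral_mul_center_le hF (W := A.indicator 1)
    (Measurable.indicator (@measurable_const _ _ _ F 1) hA) hAb hm (fun ω => sq_nonneg _) hb
    (sq_nonneg T)
    (fun t ht => Mon.condDiscrepancyLE_sq hF hZ hδ hZF hg ht)
  have e1 : ∫ ω, A.indicator (1 : Ω → ℝ) ω * center P (fun ω => max (g (Z ω)) 0 ^ 2) ω ∂P =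
      ∫ ω in A, max (g (Z ω)) 0 ^ 2 ∂P - P.real A * ∫ ω, max (g (Z ω)) 0 ^ 2 ∂P := by
    have : ∀ ω, A.indicator (1 : Ω → ℝ) ω * center P (fun ω => max (g (Z ω)) 0 ^ 2) ω =
        A.indicator (center P (fun ω => max (g (Z ω)) 0 ^ 2)) ω := fun ω => by
      by_cases h : ω ∈ A <;> simp [h]
    simp_rw [this]
    rw [integral_indicator hAm]
    unfold center
    rw [integral_sub hi.integrableOn (integrable_const _), setIntegral_const, smul_eq_mul]
  have e2 : ∫ ω, |A.indicator (1 : Ω → ℝ) ω| ∂P = P.real A := by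
    rw [← integral_indicator_one hAm]
    refine integral_congr_ae (Filter.Eventually.of_forall fun ω => ?_)
    by_cases h : ω ∈ A <;> simp [h]
  rw [e1, e2] at key
  linarith [(abs_le.1 key).2]

lemma sq_eq_max_sq_add (x : ℝ) : x ^ 2 = max x 0 ^ 2 + max (-x) 0 ^ 2 := by
  rcases le_total 0 x with h | h
  · simp [h]
  · simp [h]

lemma eq_max_sub_max (x : ℝ) : x = max x 0 - max (-x) 0 := by
  rcases le_total 0 x with h | h
  · simp [h]
  · simp [h]

lemma Mon.integrable_max_sq (hZ : Measurable Z) (hg : g ∈ Mon 2 M μ) (hgT : ∀ x, |g x| ≤ T)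
    (hT : 0 ≤ T) : Integrable (fun ω => max (g (Z ω)) 0 ^ 2) P :=
  integrable_of_bounded ((((Mon.measurable hg).comp hZ).max measurable_const).pow_const 2)
    (c := T ^ 2) fun ω => by
      rw [abs_of_nonneg (sq_nonneg _)]
      exact pow_le_pow_left₀ (le_max_right _ _) (max_le ((le_abs_self _).trans (hgT _)) hT) 2

lemma Mon.setIntegral_sq_eq (hZ : Measurable Z) (hg : g ∈ Mon 2 M μ) (hgT : ∀ x, |g x| ≤ T)
    (hT : 0 ≤ T) (A : Set Ω) : ∫ ω in A, g (Z ω) ^ 2 ∂P =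
      ∫ ω in A, max (g (Z ω)) 0 ^ 2 ∂P + ∫ ω in A, max (-g (Z ω)) 0 ^ 2 ∂P := by
  have h2 := (Mon.integrable_max_sq (P := P) hZ (Mon.neg_mem hg) (by simpa using hgT) hT)
  simp only [Pi.neg_apply] at h2
  rw [← integral_add (Mon.integrable_max_sq hZ hg hgT hT).integrableOn h2.integrableOn]
  simp_rw [← sq_eq_max_sq_add]

lemma Mon.integral_sq_eq (hZ : Measurable Z) (hg : g ∈ Mon 2 M μ) (hgT : ∀ x, |g x| ≤ T)
    (hT : 0 ≤ T) : ∫ ω, g (Z ω) ^ 2 ∂P =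
      ∫ ω, max (g (Z ω)) 0 ^ 2 ∂P + ∫ ω, max (-g (Z ω)) 0 ^ 2 ∂P := by
  simpa using Mon.setIntegral_sq_eq (P := P) hZ hg hgT hT Set.univ

lemma Mon.setIntegral_sq_le (hF : F ≤ mΩ) (hZ : Measurable Z) (hδ : 0 ≤ δ)
    (hZF : ∀ x, CondDiscrepancyLE F P {ω | Z ω ≤ x} δ) (hg : g ∈ Mon 2 M μ)
    (hgT : ∀ x, |g x| ≤ T) (hT : 0 ≤ T) {A : Set Ω} (hA : MeasurableSet[F] A) :
    ∫ ω in A, g (Z ω) ^ 2 ∂P ≤ P.real A * (∫ ω, g (Z ω) ^ 2 ∂P + 4 * δ * T ^ 2) := by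
  have h1 := Mon.setIntegral_max_sq_le hF hZ hδ hZF hg hgT hT hA
  have h2 := Mon.setIntegral_max_sq_le hF hZ hδ hZF (Mon.neg_mem hg) (by simpa using hgT) hT hA
  rw [Mon.setIntegral_sq_eq hZ hg hgT hT, Mon.integral_sq_eq hZ hg hgT hT]
  simp only [Pi.neg_apply] at h2
  linarith

/-- The positive and negative parts are treated separately; their squares add up to g², so only the
term in W² is doubled. -/
lemma Mon.abs_integral_mul_center_le (hF : F ≤ mΩ) (hZ : Measurable Z) (hδ : 0 ≤ δ)
    (hZF : ∀ x, CondDiscrepancyLE F P {ω | Z ω ≤ x} δ) (hg : g ∈ Mon 2 M μ)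
    (hgT : ∀ x, |g x| ≤ T) (hT : 0 ≤ T) {A : Set Ω} (hA : MeasurableSet A) {W : Ω → ℝ}
    (hW : Measurable[F] W) {c : ℝ} (hc : ∀ ω, |W ω| ≤ c) (hWA : ∀ ω ∉ A, W ω = 0) :
    |∫ ω, W ω * center P (fun ω => g (Z ω)) ω ∂P| ≤ √δ * (2 * ∫ ω, W ω ^ 2 ∂P +
      ∫ ω in A, g (Z ω) ^ 2 ∂P + P.real A * ∫ ω, g (Z ω) ^ 2 ∂P) := by
  have hWm : Measurable W := hW.mono hF le_rfl
  have hm : ∀ {u : ℝ → ℝ}, u ∈ Mon 2 M μ → Measurable fun ω => max (u (Z ω)) 0 := fun hu =>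
    ((Mon.measurable hu).comp hZ).max measurable_const
  have hb : ∀ {u : ℝ → ℝ}, (∀ x, |u x| ≤ T) → ∀ ω, max (u (Z ω)) 0 ≤ T := fun hu ω =>
    max_le ((le_abs_self _).trans (hu _)) hT
  have hi : ∀ {u : ℝ → ℝ}, u ∈ Mon 2 M μ → (∀ x, |u x| ≤ T) →
      Integrable (fun ω => max (u (Z ω)) 0) P := fun hu hu' =>
    integrable_of_bounded (hm hu) fun ω => by
      rw [abs_of_nonneg (le_max_right _ _)]; exact hb hu' ω
  have hiW : ∀ {u : ℝ → ℝ}, u ∈ Mon 2 M μ → (∀ x, |u x| ≤ T) →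
      Integrable (fun ω => W ω * center P (fun ω => max (u (Z ω)) 0) ω) P := fun hu hu' =>
    ((hi hu hu').sub (integrable_const _)).bdd_mul hWm.aestronglyMeasurable
      (Filter.Eventually.of_forall hc)
  have hng := Mon.neg_mem hg
  have hngT : ∀ x, |(-g) x| ≤ T := by simpa using hgT
  have key : ∀ {u : ℝ → ℝ}, u ∈ Mon 2 M μ → (∀ x, |u x| ≤ T) → _ := fun {u} hu hu' =>
    abs_integral_mul_center_le_sq (P := P) hF hW hc (hm hu) (fun ω => le_max_right _ _) (hb hu') hT
      hδ hA hWA fun t ht => Mon.condDiscrepancyLE hF hZ hδ hZF hu ht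
  have e : ∫ ω, W ω * center P (fun ω => g (Z ω)) ω ∂P =
      (∫ ω, W ω * center P (fun ω => max (g (Z ω)) 0) ω ∂P) -
      ∫ ω, W ω * center P (fun ω => max ((-g) (Z ω)) 0) ω ∂P := by
    rw [← integral_sub (hiW hg hgT) (hiW hng hngT)]
    refine integral_congr_ae (Filter.Eventually.of_forall fun ω => ?_)
    have e2 : ∫ ω, g (Z ω) ∂P = ∫ ω, max (g (Z ω)) 0 ∂P - ∫ ω, max ((-g) (Z ω)) 0 ∂P := by
      rw [← integral_sub (hi hg hgT) (hi hng hngT)]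
      simp_rw [Pi.neg_apply, ← eq_max_sub_max]
    simp only [center]
    rw [e2, Pi.neg_apply]
    nth_rewrite 1 [eq_max_sub_max (g (Z ω))]
    ring
  rw [e, Mon.setIntegral_sq_eq hZ hg hgT hT, Mon.integral_sq_eq hZ hg hgT hT]
  have k1 := key hg hgT
  have k2 := key hng hngT
  simp only [Pi.neg_apply] at k2 ⊢
  refine (abs_sub _ _).trans ((add_le_add k1 k2).trans (le_of_eq ?_))
  ring

end SingleFunction

/-! ### Bounded combinations of monotonic pieces. -/

section MonComb

variable {Ω : Type*} {F : MeasurableSpace Ω} [mΩ : MeasurableSpace Ω] {P : Measure Ω}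
  [IsProbabilityMeasure P] {M T : ℝ} {μ : Measure ℝ} {h G : ℝ → ℝ} {Z : Ω → ℝ} {δ : ℝ}

lemma IsBoundedMonComb.measurable (H : IsBoundedMonComb M T μ h G) : Measurable h := by
  obtain ⟨L, a, g, hg, -, -, rfl, -⟩ := H
  exact Finset.measurable_fun_sum _ fun l _ => (Mon.measurable (hg l)).const_mul _

lemma IsBoundedMonComb.measurable_sq (H : IsBoundedMonComb M T μ h G) : Measurable G := by
  obtain ⟨L, a, g, hg, -, -, -, rfl⟩ := H
  exact Finset.measurable_fun_sum _ fun l _ => ((Mon.measurable (hg l)).pow_const 2).const_mul _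

lemma IsBoundedMonComb.nonneg (H : IsBoundedMonComb M T μ h G) (x : ℝ) : 0 ≤ G x := by
  obtain ⟨L, a, g, -, -, -, -, rfl⟩ := H
  exact Finset.sum_nonneg fun l _ => by positivity

lemma IsBoundedMonComb.abs_le (H : IsBoundedMonComb M T μ h G) (hT : 0 ≤ T) (x : ℝ) :
    |h x| ≤ T := by
  obtain ⟨L, a, g, -, hgT, ha, rfl, -⟩ := H
  calc |∑ l, a l * g l x| ≤ ∑ l, |a l * g l x| := Finset.abs_sum_le_sum_abs _ _
    _ ≤ ∑ l, |a l| * T := Finset.sum_le_sum fun l _ => by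
        rw [abs_mul]; exact mul_le_mul_of_nonneg_left (hgT l x) (abs_nonneg _)
    _ = (∑ l, |a l|) * T := by rw [Finset.sum_mul]
    _ ≤ 1 * T := mul_le_mul_of_nonneg_right ha hT
    _ = T := one_mul T

lemma IsBoundedMonComb.sq_le_sq (H : IsBoundedMonComb M T μ h G) (x : ℝ) :
    G x ≤ T ^ 2 := by
  obtain ⟨L, a, g, -, hgT, ha, -, rfl⟩ := H
  calc ∑ l, |a l| * g l x ^ 2 ≤ ∑ l, |a l| * T ^ 2 := Finset.sum_le_sum fun l _ => by
        refine mul_le_mul_of_nonneg_left ?_ (abs_nonneg _)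
        rw [← sq_abs]
        exact pow_le_pow_left₀ (abs_nonneg _) (hgT l x) 2
    _ = (∑ l, |a l|) * T ^ 2 := by rw [Finset.sum_mul]
    _ ≤ 1 * T ^ 2 := mul_le_mul_of_nonneg_right ha (sq_nonneg _)
    _ = T ^ 2 := one_mul _

/-- Cauchy–Schwarz with weights |a_l| of total mass at most 1. This is the purpose of G: it
dominates h² and, being linear in the g_l², inherits the estimates for single pieces by summation.
-/
lemma IsBoundedMonComb.sq_le (H : IsBoundedMonComb M T μ h G) (x : ℝ) : h x ^ 2 ≤ G x := by
  obtain ⟨L, a, g, -, -, ha, rfl, rfl⟩ := H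
  have h1 := Finset.sum_sq_le_sum_mul_sum_of_sq_le_mul Finset.univ
    (r := fun l => a l * g l x) (f := fun l => |a l|) (g := fun l => |a l| * g l x ^ 2)
    (fun l _ => abs_nonneg _) (fun l _ => by positivity)
    (fun l _ => le_of_eq (by rw [mul_pow, ← sq_abs (a l)]; ring))
  refine h1.trans ?_
  have h2 : 0 ≤ ∑ l, |a l| * g l x ^ 2 := Finset.sum_nonneg fun l _ => by positivity
  nlinarith

lemma IsBoundedMonComb.integrable (H : IsBoundedMonComb M T μ h G) (hZ : Measurable Z)
    (hT : 0 ≤ T) : Integrable (fun ω => h (Z ω)) P :=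
  integrable_of_bounded (H.measurable.comp hZ) fun _ => H.abs_le hT _

lemma IsBoundedMonComb.integrable_sq (H : IsBoundedMonComb M T μ h G) (hZ : Measurable Z) :
    Integrable (fun ω => G (Z ω)) P :=
  integrable_of_bounded (c := T ^ 2) (H.measurable_sq.comp hZ) fun _ => by
    rw [abs_of_nonneg (H.nonneg _)]; exact H.sq_le_sq _

lemma integrable_sq_comp {g : ℝ → ℝ} (hg : g ∈ Mon 2 M μ) (hgT : ∀ x, |g x| ≤ T)
    (hZ : Measurable Z) : Integrable (fun ω => g (Z ω) ^ 2) P :=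
  integrable_of_bounded (((Mon.measurable hg).comp hZ).pow_const 2) (c := T ^ 2) fun ω => by
    rw [abs_pow]; exact pow_le_pow_left₀ (abs_nonneg _) (hgT _) 2

lemma integral_sq_comp_le {g : ℝ → ℝ} (hg : g ∈ Mon 2 M μ) (hZ : Measurable Z)
    (hμ : P.map Z = μ) : ∫ ω, g (Z ω) ^ 2 ∂P ≤ M ^ 2 := by
  subst hμ
  have : IsProbabilityMeasure (P.map Z) := Measure.isProbabilityMeasure_map hZ.aemeasurable
  rw [← integral_map (f := fun x => g x ^ 2) hZ.aemeasurable
    ((Mon.measurable hg).pow_const 2).aestronglyMeasurable]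
  exact Mon.integral_sq_le hg

lemma IsBoundedMonComb.integral_sq_le (H : IsBoundedMonComb M T μ h G) (hZ : Measurable Z)
    (hμ : P.map Z = μ) : ∫ ω, G (Z ω) ∂P ≤ M ^ 2 := by
  obtain ⟨L, a, g, hg, hgT, ha, -, rfl⟩ := H
  rw [integral_finsetSum _ fun l _ => (integrable_sq_comp (hg l) (hgT l) hZ).const_mul _]
  simp_rw [integral_const_mul]
  calc ∑ l, |a l| * ∫ ω, g l (Z ω) ^ 2 ∂P ≤ ∑ l, |a l| * M ^ 2 := Finset.sum_le_sum fun l _ =>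
        mul_le_mul_of_nonneg_left (integral_sq_comp_le (hg l) hZ hμ) (abs_nonneg _)
    _ = (∑ l, |a l|) * M ^ 2 := by rw [Finset.sum_mul]
    _ ≤ 1 * M ^ 2 := mul_le_mul_of_nonneg_right ha (sq_nonneg _)
    _ = M ^ 2 := one_mul _

lemma IsBoundedMonComb.setIntegral_sq_le (H : IsBoundedMonComb M T μ h G) (hF : F ≤ mΩ)
    (hZ : Measurable Z) (hμ : P.map Z = μ) (hδ : 0 ≤ δ)
    (hZF : ∀ x, CondDiscrepancyLE F P {ω | Z ω ≤ x} δ) (hT : 0 ≤ T) {A : Set Ω}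
    (hA : MeasurableSet[F] A) :
    ∫ ω in A, G (Z ω) ∂P ≤ P.real A * (M ^ 2 + 4 * δ * T ^ 2) := by
  obtain ⟨L, a, g, hg, hgT, ha, -, rfl⟩ := H
  rw [integral_finsetSum _ fun l _ =>
    ((integrable_sq_comp (hg l) (hgT l) hZ).const_mul _).integrableOn]
  simp_rw [integral_const_mul]
  calc ∑ l, |a l| * ∫ ω in A, g l (Z ω) ^ 2 ∂P
      ≤ ∑ l, |a l| * (P.real A * (M ^ 2 + 4 * δ * T ^ 2)) := Finset.sum_le_sum fun l _ => by
        refine mul_le_mul_of_nonneg_left ?_ (abs_nonneg _)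
        refine (Mon.setIntegral_sq_le hF hZ hδ hZF (hg l) (hgT l) hT hA).trans ?_
        gcongr
        exact integral_sq_comp_le (hg l) hZ hμ
    _ = (∑ l, |a l|) * (P.real A * (M ^ 2 + 4 * δ * T ^ 2)) := by rw [Finset.sum_mul]
    _ ≤ 1 * (P.real A * (M ^ 2 + 4 * δ * T ^ 2)) :=
        mul_le_mul_of_nonneg_right ha (by positivity)
    _ = _ := one_mul _

lemma IsBoundedMonComb.abs_integral_mul_center_le (H : IsBoundedMonComb M T μ h G) (hF : F ≤ mΩ)
    (hZ : Measurable Z) (hμ : P.map Z = μ) (hδ : 0 ≤ δ)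
    (hZF : ∀ x, CondDiscrepancyLE F P {ω | Z ω ≤ x} δ) (hT : 0 ≤ T) {A : Set Ω}
    (hA : MeasurableSet A) {W : Ω → ℝ} (hW : Measurable[F] W) {c : ℝ} (hc : ∀ ω, |W ω| ≤ c)
    (hWA : ∀ ω ∉ A, W ω = 0) :
    |∫ ω, W ω * center P (fun ω => h (Z ω)) ω ∂P| ≤ √δ * (2 * ∫ ω, W ω ^ 2 ∂P +
      ∫ ω in A, G (Z ω) ∂P + P.real A * M ^ 2) := by
  obtain ⟨L, a, g, hg, hgT, ha, rfl, rfl⟩ := H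
  have hWm : Measurable W := hW.mono hF le_rfl
  have hi : ∀ l, Integrable (fun ω => g l (Z ω)) P := fun l =>
    integrable_of_bounded ((Mon.measurable (hg l)).comp hZ) fun ω => hgT l _
  have hiW : ∀ l, Integrable (fun ω => W ω * center P (fun ω => g l (Z ω)) ω) P := fun l =>
    ((hi l).sub (integrable_const _)).bdd_mul hWm.aestronglyMeasurable
      (Filter.Eventually.of_forall hc)
  have e : ∫ ω, W ω * center P (fun ω => ∑ l, a l * g l (Z ω)) ω ∂P =
      ∑ l, a l * ∫ ω, W ω * center P (fun ω => g l (Z ω)) ω ∂P := by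
    simp_rw [← integral_const_mul]
    rw [← integral_finsetSum _ fun l _ => (hiW l).const_mul _]
    refine integral_congr_ae (Filter.Eventually.of_forall fun ω => ?_)
    simp only [center]
    rw [integral_finsetSum _ fun l _ => (hi l).const_mul _, ← Finset.sum_sub_distrib,
      Finset.mul_sum]
    refine Finset.sum_congr rfl fun l _ => ?_
    rw [integral_const_mul]
    ring
  have hW2 : 0 ≤ ∫ ω, W ω ^ 2 ∂P := integral_nonneg fun ω => sq_nonneg _
  rw [e]
  refine (Finset.abs_sum_le_sum_abs _ _).trans ?_
  rw [integral_finsetSum _ fun l _ =>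
    ((integrable_sq_comp (hg l) (hgT l) hZ).const_mul _).integrableOn]
  simp_rw [integral_const_mul]
  calc ∑ l, |a l * ∫ ω, W ω * center P (fun ω => g l (Z ω)) ω ∂P|
      ≤ ∑ l, (|a l| * (√δ * (2 * ∫ ω, W ω ^ 2 ∂P + P.real A * M ^ 2)) +
          √δ * (|a l| * ∫ ω in A, g l (Z ω) ^ 2 ∂P)) := Finset.sum_le_sum fun l _ => by
        rw [abs_mul]
        have h1 : |∫ ω, W ω * center P (fun ω => g l (Z ω)) ω ∂P| ≤ √δ * (2 * ∫ ω, W ω ^ 2 ∂P +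
            ∫ ω in A, g l (Z ω) ^ 2 ∂P + P.real A * M ^ 2) := by
          refine (Mon.abs_integral_mul_center_le hF hZ hδ hZF (hg l) (hgT l) hT hA hW hc
            hWA).trans ?_
          gcongr
          exact integral_sq_comp_le (hg l) hZ hμ
        exact (mul_le_mul_of_nonneg_left h1 (abs_nonneg _)).trans (le_of_eq (by ring))
    _ = (∑ l, |a l|) * (√δ * (2 * ∫ ω, W ω ^ 2 ∂P + P.real A * M ^ 2)) +
          √δ * ∑ l, |a l| * ∫ ω in A, g l (Z ω) ^ 2 ∂P := by
        rw [Finset.sum_add_distrib, Finset.sum_mul, Finset.mul_sum]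
    _ ≤ 1 * (√δ * (2 * ∫ ω, W ω ^ 2 ∂P + P.real A * M ^ 2)) +
          √δ * ∑ l, |a l| * ∫ ω in A, g l (Z ω) ^ 2 ∂P := by
        gcongr
    _ = _ := by ring

lemma IsBoundedMonComb.sq_integral_le (H : IsBoundedMonComb M T μ h G)
    (hZ : Measurable Z) (hμ : P.map Z = μ) (hT : 0 ≤ T) : (∫ ω, h (Z ω) ∂P) ^ 2 ≤ M ^ 2 := by
  have hi : Integrable (fun ω => h (Z ω)) P := H.integrable hZ hT
  have hi2 : Integrable (fun ω => h (Z ω) ^ 2) P :=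
    integrable_of_bounded ((H.measurable.comp hZ).pow_const 2) (c := T ^ 2) fun ω => by
      rw [abs_pow]; exact pow_le_pow_left₀ (abs_nonneg _) (H.abs_le hT _) 2
  refine le_trans ?_ ((integral_mono hi2 (H.integrable_sq hZ) fun ω => H.sq_le _).trans
    (H.integral_sq_le hZ hμ))
  -- Nonnegativity of the variance gives (E h)² ≤ E h².
  have h0 : 0 ≤ ∫ ω, (h (Z ω) - ∫ ω', h (Z ω') ∂P) ^ 2 ∂P := integral_nonneg fun ω => sq_nonneg _
  have e : ∀ ω, (h (Z ω) - ∫ ω', h (Z ω') ∂P) ^ 2 =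
      h (Z ω) ^ 2 - 2 * (∫ ω', h (Z ω') ∂P) * h (Z ω) + (∫ ω', h (Z ω') ∂P) ^ 2 := fun ω => by ring
  simp_rw [e] at h0
  have hi3 : Integrable
      (fun ω => h (Z ω) ^ 2 - (2 * ∫ ω', h (Z ω') ∂P) * h (Z ω)) P := hi2.sub (hi.const_mul _)
  rw [integral_add hi3 (integrable_const _), integral_sub hi2 (hi.const_mul _),
    integral_const_mul] at h0
  simp only [integral_const, probReal_univ, smul_eq_mul, one_mul] at h0
  nlinarith

lemma IsBoundedMonComb.abs_center_le (H : IsBoundedMonComb M T μ h G) (hT : 0 ≤ T) (ω : Ω) :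
    |center P (fun ω => h (Z ω)) ω| ≤ 2 * T := by
  have h1 : |∫ ω, h (Z ω) ∂P| ≤ T := by
    have := norm_integral_le_of_norm_le_const (μ := P) (f := fun ω => h (Z ω)) (C := T)
      (Filter.Eventually.of_forall fun ω => H.abs_le hT _)
    simpa using this
  calc |h (Z ω) - ∫ ω, h (Z ω) ∂P| ≤ |h (Z ω)| + |∫ ω, h (Z ω) ∂P| := abs_sub _ _
    _ ≤ 2 * T := by linarith [H.abs_le hT (Z ω)]

/-- Integrate (h - E h)² ≤ 2G + 2M² and use the conditional bound for G. -/
lemma IsBoundedMonComb.setIntegral_center_sq_le (H : IsBoundedMonComb M T μ h G) (hF : F ≤ mΩ)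
    (hZ : Measurable Z) (hμ : P.map Z = μ) (hδ : 0 ≤ δ)
    (hZF : ∀ x, CondDiscrepancyLE F P {ω | Z ω ≤ x} δ) (hT : 0 ≤ T) {A : Set Ω}
    (hA : MeasurableSet[F] A) :
    ∫ ω in A, center P (fun ω => h (Z ω)) ω ^ 2 ∂P ≤
      P.real A * (4 * M ^ 2 + 8 * δ * T ^ 2) := by
  have h1 := H.setIntegral_sq_le hF hZ hμ hδ hZF hT hA
  have h2 := H.sq_integral_le hZ hμ hT
  have hi := H.integrable_sq (P := P) hZ
  have hA0 : 0 ≤ P.real A := measureReal_nonneg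
  have hm : Measurable (center P (fun ω => h (Z ω))) := measurable_center (H.measurable.comp hZ)
  calc ∫ ω in A, center P (fun ω => h (Z ω)) ω ^ 2 ∂P
      ≤ ∫ ω in A, (2 * G (Z ω) + 2 * M ^ 2) ∂P := by
        refine integral_mono ?_ ((hi.const_mul 2).add (integrable_const _)).integrableOn
          fun ω => ?_
        · exact (integrable_of_bounded (hm.pow_const 2) (c := (2 * T) ^ 2) fun ω => by
            rw [abs_pow]
            exact pow_le_pow_left₀ (abs_nonneg _) (H.abs_center_le hT _) 2).integrableOn
        · have h3 := H.sq_le (Z ω)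
          simp only [center]
          nlinarith [sq_nonneg (h (Z ω) + ∫ ω, h (Z ω) ∂P)]
    _ = 2 * ∫ ω in A, G (Z ω) ∂P + P.real A * (2 * M ^ 2) := by
        rw [integral_add (hi.const_mul 2).integrableOn (integrable_const _), integral_const_mul,
          setIntegral_const, smul_eq_mul]
    _ ≤ _ := by nlinarith

end MonComb

/-! ### An exponential maximal inequality from conditional variances. -/

section Excursions

variable {Ω : Type*}

/-- `k` is the first time after `i` at which `S` has moved by more than `a`. -/
def firstExit (S : ℕ → Ω → ℝ) (a : ℝ) (i k : ℕ) : Set Ω :=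
  {ω | i < k ∧ a < |S k ω - S i ω| ∧ ∀ j, i < j → j < k → |S j ω - S i ω| ≤ a}

/-- `S` makes at least `Q` successive moves by more than `a` within `(i, n]`. -/
def manyExits (S : ℕ → Ω → ℝ) (a : ℝ) (n : ℕ) : ℕ → ℕ → Set Ω
  | 0, _ => Set.univ
  | Q + 1, i => ⋃ k ∈ Finset.Ioc i n, firstExit S a i k ∩ manyExits S a n Q k

variable [mΩ : MeasurableSpace Ω] {P : Measure Ω} [IsProbabilityMeasure P] {S : ℕ → Ω → ℝ} {a : ℝ}

lemma firstExit_disjoint (i : ℕ) {k k' : ℕ} (h : k ≠ k') :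
    Disjoint (firstExit S a i k) (firstExit S a i k') := by
  rw [Set.disjoint_left]
  rintro ω ⟨h1, h2, h3⟩ ⟨h1', h2', h3'⟩
  rcases lt_or_gt_of_ne h with hlt | hlt
  · exact absurd (h3' k h1 hlt) (not_le.2 h2)
  · exact absurd (h3 k' h1' hlt) (not_le.2 h2')

lemma measurableSet_firstExit {G : MeasurableSpace Ω} (i k : ℕ)
    (hS : ∀ j, j ≤ k → Measurable[G] (S j)) (hik : i < k) :
    MeasurableSet[G] (firstExit S a i k) := by
  have h1 : ∀ j, j ≤ k → MeasurableSet[G] {ω | a < |S j ω - S i ω|} := fun j hj =>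
    ((measurable_id.abs : Measurable fun x : ℝ => |x|).comp ((hS j hj).sub (hS i hik.le)))
      measurableSet_Ioi
  have e : firstExit S a i k = {ω | a < |S k ω - S i ω|} ∩
      ⋂ j ∈ Finset.Ioo i k, {ω | a < |S j ω - S i ω|}ᶜ := by
    ext ω
    simp [firstExit, hik]
  rw [e]
  refine MeasurableSet.inter (h1 k le_rfl) (Finset.measurableSet_biInter _ fun j hj => ?_)
  exact (h1 j (Finset.mem_Ioo.1 hj).2.le).compl

/-- Chebyshev's inequality on an event, for increments with conditionally bounded second moment. -/
lemma measureReal_inter_lt_abs_le {A : Set Ω} (hA : MeasurableSet A) {D : Ω → ℝ}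
    (hD : Measurable D) (hDi : Integrable (fun ω => D ω ^ 2) P) {v c : ℝ} (hc : 0 < c)
    (h : ∫ ω in A, D ω ^ 2 ∂P ≤ v * P.real A) :
    P.real (A ∩ {ω | c < |D ω|}) ≤ v / c ^ 2 * P.real A := by
  have hB : MeasurableSet {ω | c < |D ω|} := measurableSet_lt measurable_const hD.abs
  have h1 : c ^ 2 * P.real (A ∩ {ω | c < |D ω|}) ≤ ∫ ω in A ∩ {ω | c < |D ω|}, D ω ^ 2 ∂P := by
    rw [mul_comm, ← smul_eq_mul, ← setIntegral_const]
    refine setIntegral_mono_on (integrable_const _).integrableOn hDi.integrableOn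
      (hA.inter hB) fun ω hω => ?_
    rw [← sq_abs (D ω)]
    exact pow_le_pow_left₀ hc.le hω.2.le 2
  have h2 : ∫ ω in A ∩ {ω | c < |D ω|}, D ω ^ 2 ∂P ≤ ∫ ω in A, D ω ^ 2 ∂P :=
    setIntegral_mono_set hDi.integrableOn (Filter.Eventually.of_forall fun ω => sq_nonneg _)
      Set.inter_subset_left.eventuallyLE
  rw [div_mul_eq_mul_div, le_div_iff₀ (by positivity)]
  linarith

variable {ℱ : ℕ → MeasurableSpace Ω} {v : ℝ} {b : ℕ}

/-- An Ottaviani type inequality: within `b` steps, an exit from the interval of radius `6√v` has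
conditional probability at most `1/12`. -/
lemma sum_measureReal_firstExit_le (hℱ : ∀ i, ℱ i ≤ mΩ) (hmono : Monotone ℱ)
    (hS : ∀ i, Measurable[ℱ i] (S i)) (hv : 0 < v)
    (hint : ∀ i j, Integrable (fun ω => (S j ω - S i ω) ^ 2) P)
    (hvar : ∀ i m, m ≤ b → ∀ A, MeasurableSet[ℱ i] A →
      ∫ ω in A, (S (i + m) ω - S i ω) ^ 2 ∂P ≤ v * P.real A)
    (i : ℕ) {A : Set Ω} (hA : MeasurableSet[ℱ i] A) :
    ∑ k ∈ Finset.Ioc i (i + b), P.real (A ∩ firstExit S (6 * √v) i k) ≤ 1 / 12 * P.real A := by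
  have hSm : ∀ j, Measurable (S j) := fun j => (hS j).mono (hℱ j) le_rfl
  have hsv : 0 < √v := Real.sqrt_pos.2 hv
  have hsq : √v ^ 2 = v := Real.sq_sqrt hv.le
  set D : Set Ω := {ω | 4 * √v < |S (i + b) ω - S i ω|} with hD
  have hDm : MeasurableSet D := measurableSet_lt measurable_const ((hSm _).sub (hSm _)).abs
  have hAm : MeasurableSet A := hℱ i _ hA
  have hE : ∀ k ∈ Finset.Ioc i (i + b), MeasurableSet[ℱ k] (firstExit S (6 * √v) i k) :=
    fun k hk => measurableSet_firstExit i k (fun j hj => (hS j).mono (hmono hj) le_rfl)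
      (Finset.mem_Ioc.1 hk).1
  have step : ∀ k ∈ Finset.Ioc i (i + b), 3 / 4 * P.real (A ∩ firstExit S (6 * √v) i k) ≤
      P.real ((A ∩ D) ∩ firstExit S (6 * √v) i k) := by
    intro k hk
    obtain ⟨hik, hkb⟩ := Finset.mem_Ioc.1 hk
    set B := A ∩ firstExit S (6 * √v) i k with hB
    have hBk : MeasurableSet[ℱ k] B := (hmono hik.le _ hA).inter (hE k hk)
    -- Restart at the exit time k: by Chebyshev the rest of the block moves by more than 2√v with
    -- conditional probability at most 1/4. Otherwise the displacement at the end of the block still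
    -- exceeds 6√v - 2√v = 4√v.
    have h1 := hvar k (i + b - k) (by omega) B hBk
    rw [show k + (i + b - k) = i + b by omega] at h1
    have h2 := measureReal_inter_lt_abs_le (hℱ k _ hBk) ((hSm _).sub (hSm _)) (hint _ _)
      (show 0 < 2 * √v by positivity) h1
    have h3 : v / (2 * √v) ^ 2 = 1 / 4 := by
      rw [mul_pow, hsq]; field_simp; norm_num
    rw [h3] at h2
    have hC : MeasurableSet {ω | 2 * √v < |(S (i + b) - S k) ω|} :=
      measurableSet_lt measurable_const ((hSm _).sub (hSm _)).abs
    have h4 := measureReal_inter_add_sdiff (μ := P) (s := B) hC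
    have h5 : P.real (B \ {ω | 2 * √v < |(S (i + b) - S k) ω|}) ≤
        P.real ((A ∩ D) ∩ firstExit S (6 * √v) i k) := by
      refine measureReal_mono fun ω hω => ?_
      obtain ⟨⟨hωA, hωE⟩, hω2⟩ := hω
      refine ⟨⟨hωA, ?_⟩, hωE⟩
      simp only [Set.mem_ofPred_eq, not_lt, Pi.sub_apply] at hω2
      have h6 := hωE.2.1
      have h7 : |S k ω - S i ω| ≤ |S (i + b) ω - S i ω| + |S (i + b) ω - S k ω| := by
        have := abs_sub (S (i + b) ω - S i ω) (S (i + b) ω - S k ω)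
        rwa [show S (i + b) ω - S i ω - (S (i + b) ω - S k ω) = S k ω - S i ω by ring] at this
      simp only [hD, Set.mem_ofPred_eq]
      linarith
    simp only [Pi.sub_apply] at h2 h4 h5
    linarith
  have hsum : ∑ k ∈ Finset.Ioc i (i + b), P.real ((A ∩ D) ∩ firstExit S (6 * √v) i k) ≤
      P.real (A ∩ D) := by
    rw [← measureReal_biUnion_finset]
    · exact measureReal_mono (Set.iUnion₂_subset fun k _ => Set.inter_subset_left)
    · intro k _ k' _ hkk'
      exact (firstExit_disjoint i hkk').mono Set.inter_subset_right Set.inter_subset_right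
    · exact fun k hk => (hAm.inter hDm).inter (hℱ k _ (hE k hk))
  -- Chebyshev at the end of the block; comparing with the factor 3/4 above gives (1/16)/(3/4) =
  -- 1/12.
  have hAD : P.real (A ∩ D) ≤ 1 / 16 * P.real A := by
    have h1 := measureReal_inter_lt_abs_le hAm ((hSm _).sub (hSm _)) (hint _ _)
      (show 0 < 4 * √v by positivity) (hvar i b le_rfl A hA)
    have h3 : v / (4 * √v) ^ 2 = 1 / 16 := by
      rw [mul_pow, hsq]; field_simp; norm_num
    rw [h3] at h1
    exact h1
  have := Finset.sum_le_sum step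
  rw [← Finset.mul_sum] at this
  linarith

/-- Each move either ends within b steps, which has probability at most 1/12, or uses up b steps,
which lowers the prefactor 12^((n-i)/b) by 12. Both alternatives contribute 1/12, so each move costs
1/6. -/
lemma measureReal_inter_manyExits_le (hℱ : ∀ i, ℱ i ≤ mΩ) (hmono : Monotone ℱ)
    (hS : ∀ i, Measurable[ℱ i] (S i)) (hv : 0 < v) (hb : 0 < b)
    (hint : ∀ i j, Integrable (fun ω => (S j ω - S i ω) ^ 2) P)
    (hvar : ∀ i m, m ≤ b → ∀ A, MeasurableSet[ℱ i] A →
      ∫ ω in A, (S (i + m) ω - S i ω) ^ 2 ∂P ≤ v * P.real A)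
    (n Q i : ℕ) (hin : i ≤ n) {A : Set Ω} (hA : MeasurableSet[ℱ i] A) :
    P.real (A ∩ manyExits S (6 * √v) n Q i) ≤
      (12 : ℝ) ^ (((n : ℝ) - i) / b) * (1 / 6) ^ Q * P.real A := by
  have hSm : ∀ j, Measurable (S j) := fun j => (hS j).mono (hℱ j) le_rfl
  induction Q generalizing i A with
  | zero =>
    have h1 : (1 : ℝ) ≤ (12 : ℝ) ^ (((n : ℝ) - i) / b) := by
      refine Real.one_le_rpow (by norm_num) (div_nonneg ?_ (by positivity))
      exact sub_nonneg.2 (by exact_mod_cast hin)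
    have h0 : 0 ≤ P.real A := measureReal_nonneg
    simp only [manyExits, Set.inter_univ, pow_zero, mul_one]
    nlinarith
  | succ Q ih =>
    have hAm : MeasurableSet A := hℱ i _ hA
    have hE : ∀ k ∈ Finset.Ioc i n, MeasurableSet[ℱ k] (firstExit S (6 * √v) i k) :=
      fun k hk => measurableSet_firstExit i k (fun j hj => (hS j).mono (hmono hj) le_rfl)
        (Finset.mem_Ioc.1 hk).1
    set R : ℝ := (12 : ℝ) ^ (((n : ℝ) - i) / b) with hR
    have hR0 : 0 < R := by positivity
    set q : ℕ → ℝ := fun k => P.real (A ∩ firstExit S (6 * √v) i k) with hq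
    have hq0 : ∀ k, 0 ≤ q k := fun k => measureReal_nonneg
    have hb' : (0 : ℝ) < b := by exact_mod_cast hb
    have hterm : ∀ k ∈ Finset.Ioc i n,
        P.real (A ∩ (firstExit S (6 * √v) i k ∩ manyExits S (6 * √v) n Q k)) ≤
        R * (1 / 6) ^ Q * ((if k ∈ Finset.Ioc i (i + b) then q k else 0) + 1 / 12 * q k) := by
      intro k hk
      obtain ⟨hik, hkn⟩ := Finset.mem_Ioc.1 hk
      have h1 := ih k hkn (A := A ∩ firstExit S (6 * √v) i k)
        ((hmono hik.le _ hA).inter (hE k hk))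
      rw [Set.inter_assoc] at h1
      refine h1.trans ?_
      have hik' : (i : ℝ) ≤ k := by exact_mod_cast hik.le
      have h2 : (12 : ℝ) ^ (((n : ℝ) - k) / b) * q k ≤
          R * ((if k ∈ Finset.Ioc i (i + b) then q k else 0) + 1 / 12 * q k) := by
        by_cases hkb : k ∈ Finset.Ioc i (i + b)
        · rw [if_pos hkb]
          have h3 : (12 : ℝ) ^ (((n : ℝ) - k) / b) ≤ R :=
            Real.rpow_le_rpow_of_exponent_le (by norm_num) (by gcongr)
          have := mul_le_mul_of_nonneg_right h3 (hq0 k)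
          nlinarith [mul_nonneg hR0.le (hq0 k)]
        · rw [if_neg hkb, zero_add]
          have hk' : i + b < k := by
            simp only [Finset.mem_Ioc, not_and, not_le] at hkb
            exact hkb hik
          have hk'' : (i : ℝ) + b ≤ k := by exact_mod_cast hk'.le
          -- A slow move: k > i + b lowers the exponent by at least one.
          have h3 : (12 : ℝ) ^ (((n : ℝ) - k) / b) ≤ R * (1 / 12) := by
            have e : R * (1 / 12) = (12 : ℝ) ^ (((n : ℝ) - i) / b - 1) := by
              rw [Real.rpow_sub_one (by norm_num)]; ring
            rw [e]
            refine Real.rpow_le_rpow_of_exponent_le (by norm_num) ?_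
            rw [div_sub_one hb'.ne']
            exact div_le_div_of_nonneg_right (by linarith) hb'.le
          have := mul_le_mul_of_nonneg_right h3 (hq0 k)
          linarith
      have h6 : (0 : ℝ) ≤ (1 / 6) ^ Q := by positivity
      calc (12 : ℝ) ^ (((n : ℝ) - k) / b) * (1 / 6) ^ Q * q k
          = (1 / 6) ^ Q * ((12 : ℝ) ^ (((n : ℝ) - k) / b) * q k) := by ring
        _ ≤ (1 / 6) ^ Q *
            (R * ((if k ∈ Finset.Ioc i (i + b) then q k else 0) + 1 / 12 * q k)) :=
          mul_le_mul_of_nonneg_left h2 h6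
        _ = _ := by ring
    have hs1 : ∑ k ∈ Finset.Ioc i n, (if k ∈ Finset.Ioc i (i + b) then q k else 0) ≤
        1 / 12 * P.real A := by
      refine le_trans ?_ (sum_measureReal_firstExit_le hℱ hmono hS hv hint hvar i hA)
      rw [← Finset.sum_filter]
      exact Finset.sum_le_sum_of_subset_of_nonneg (fun k hk => (Finset.mem_filter.1 hk).2)
        fun k _ _ => hq0 k
    have hs2 : ∑ k ∈ Finset.Ioc i n, q k ≤ P.real A := by
      rw [hq, ← measureReal_biUnion_finset]
      · exact measureReal_mono (Set.iUnion₂_subset fun k _ => Set.inter_subset_left)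
      · intro k _ k' _ hkk'
        exact (firstExit_disjoint i hkk').mono Set.inter_subset_right Set.inter_subset_right
      · exact fun k hk => hAm.inter (hℱ k _ (hE k hk))
    simp only [manyExits]
    rw [Set.inter_iUnion₂]
    refine (measureReal_biUnion_finset_le _ _).trans ((Finset.sum_le_sum hterm).trans ?_)
    rw [← Finset.mul_sum, Finset.sum_add_distrib, ← Finset.mul_sum]
    have h6 : (0 : ℝ) ≤ R * (1 / 6) ^ Q := by positivity
    calc _ ≤ R * (1 / 6) ^ Q * (1 / 12 * P.real A + 1 / 12 * P.real A) := by
          gcongr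
      _ = _ := by rw [pow_succ]; ring

/-- If `S` has jumps bounded by `J` and moves by more than `Q (a + J)`, then it makes at least `Q`
successive moves by more than `a`. -/
lemma mem_manyExits {J : ℝ} (ha : 0 ≤ a) {ω : Ω} (hJ : ∀ i, |S (i + 1) ω - S i ω| ≤ J)
    (n Q i : ℕ) {k : ℕ} (hik : i ≤ k) (hkn : k ≤ n)
    (hk : Q * (a + J) < |S k ω - S i ω|) : ω ∈ manyExits S a n Q i := by
  have hJ0 : 0 ≤ J := (abs_nonneg _).trans (hJ 0)
  induction Q generalizing i with
  | zero => trivial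
  | succ Q ih =>
    push_cast at hk
    have hQ : (0 : ℝ) ≤ Q * (a + J) := by positivity
    have hex : ∃ j, i < j ∧ a < |S j ω - S i ω| := by
      refine ⟨k, lt_of_le_of_ne hik ?_, by nlinarith⟩
      rintro rfl
      simp only [sub_self, abs_zero] at hk
      nlinarith
    classical
    obtain ⟨hj1, hj2⟩ := Nat.find_spec hex
    set j := Nat.find hex with hj
    have hjmin : ∀ j', i < j' → j' < j → |S j' ω - S i ω| ≤ a := fun j' h1 h2 => by
      have := Nat.find_min hex h2
      push Not at this
      exact this h1
    have hjk : j ≤ k := Nat.find_min' hex ⟨by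
      refine lt_of_le_of_ne hik ?_
      rintro rfl
      simp only [sub_self, abs_zero] at hk
      nlinarith, by nlinarith⟩
    -- Just before the exit the displacement is at most a, and the last jump adds at most J; a
    -- distance Q(a + J) therefore cannot be covered in fewer than Q moves.
    have hjJ : |S j ω - S i ω| ≤ a + J := by
      obtain ⟨m, hm⟩ : ∃ m, j = m + 1 := ⟨j - 1, by omega⟩
      have h1 : |S m ω - S i ω| ≤ a := by
        rcases Nat.lt_or_ge i m with h | h
        · exact hjmin m h (by omega)
        · have : m = i := by omega
          simpa [this] using ha
      rw [hm]
      calc |S (m + 1) ω - S i ω| = |(S (m + 1) ω - S m ω) + (S m ω - S i ω)| := by ring_nf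
        _ ≤ |S (m + 1) ω - S m ω| + |S m ω - S i ω| := abs_add_le _ _
        _ ≤ a + J := by linarith [hJ m]
    have hrest : Q * (a + J) < |S k ω - S j ω| := by
      have : |S k ω - S i ω| ≤ |S k ω - S j ω| + |S j ω - S i ω| := abs_sub_le _ _ _
      linarith
    simp only [manyExits, Set.mem_iUnion]
    exact ⟨j, Finset.mem_Ioc.2 ⟨hj1, hjk.trans hkn⟩, ⟨hj1, hj2, hjmin⟩, ih j hjk hrest⟩

lemma measureReal_exists_lt_abs_le (hℱ : ∀ i, ℱ i ≤ mΩ) (hmono : Monotone ℱ)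
    (hS : ∀ i, Measurable[ℱ i] (S i)) (hv : 0 < v) (hb : 0 < b)
    (hint : ∀ i j, Integrable (fun ω => (S j ω - S i ω) ^ 2) P)
    (hvar : ∀ i m, m ≤ b → ∀ A, MeasurableSet[ℱ i] A →
      ∫ ω in A, (S (i + m) ω - S i ω) ^ 2 ∂P ≤ v * P.real A)
    {J : ℝ} (hJ : ∀ i ω, |S (i + 1) ω - S i ω| ≤ J) (hS0 : ∀ ω, S 0 ω = 0) (n Q : ℕ) :
    P.real {ω | ∃ k ≤ n, Q * (6 * √v + J) < |S k ω|} ≤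
      (12 : ℝ) ^ ((n : ℝ) / b) * (1 / 6) ^ Q := by
  refine (measureReal_mono (s₂ := Set.univ ∩ manyExits S (6 * √v) n Q 0) ?_).trans
    ((measureReal_inter_manyExits_le hℱ hmono hS hv hb hint hvar n Q 0 (Nat.zero_le _)
      (@MeasurableSet.univ _ (ℱ 0))).trans (le_of_eq (by simp)))
  rintro ω ⟨k, hkn, hk⟩
  refine ⟨trivial, mem_manyExits (by positivity) (fun i => hJ i ω) n Q 0 (Nat.zero_le k) hkn ?_⟩
  simpa [hS0 ω] using hk

end Excursions

/-! ### Stationarity and the conditional second moment of partial sums. -/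

section SecondMoment

variable {Ω : Type*} {F₀ : MeasurableSpace Ω} [mΩ : MeasurableSpace Ω] {P : Measure Ω}
  [IsProbabilityMeasure P] {θ : Ω ≃ᵐ Ω} {Y₀ : Ω → ℝ} {Y : ℕ → Ω → ℝ} {e : ℕ → ℝ}

/-- A stationary sequence adapted to the filtration generated by `F₀` and `θ`, whose conditional
distribution functions given `F₀` are uniformly close to the unconditional one at rate `e`. -/
structure IsStationaryMixing (F₀ : MeasurableSpace Ω) [mΩ : MeasurableSpace Ω] (P : Measure Ω)
    (θ : Ω ≃ᵐ Ω) (Y₀ : Ω → ℝ) (Y : ℕ → Ω → ℝ) (e : ℕ → ℝ) : Prop where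
  preserving : MeasurePreserving θ P P
  le : F₀ ≤ mΩ
  le_comap : F₀ ≤ F₀.comap θ
  measurable_zero : Measurable[F₀] Y₀
  eq_comp : ∀ i ω, Y i ω = Y₀ (θ^[i] ω)
  nonneg : ∀ k, 0 ≤ e k
  disc : ∀ k x, CondDiscrepancyLE F₀ P {ω | Y k ω ≤ x} (e k)
  summable : Summable fun k => √(e k)

namespace IsStationaryMixing

lemma preserving_iterate (hY : IsStationaryMixing F₀ P θ Y₀ Y e)
    (i : ℕ) : MeasurePreserving (θ^[i]) P P := hY.preserving.iterate i

lemma comap_le (hY : IsStationaryMixing F₀ P θ Y₀ Y e) (i : ℕ) : F₀.comap (θ^[i]) ≤ mΩ :=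
  (MeasurableSpace.comap_mono hY.le).trans (hY.preserving_iterate i).measurable.comap_le

lemma comap_mono (hY : IsStationaryMixing F₀ P θ Y₀ Y e)
    : Monotone fun i : ℕ => F₀.comap (θ^[i]) := by
  refine monotone_nat_of_le_succ fun i => ?_
  rw [Function.iterate_succ', ← MeasurableSpace.comap_comp]
  exact MeasurableSpace.comap_mono hY.le_comap

lemma measurable (hY : IsStationaryMixing F₀ P θ Y₀ Y e) (i : ℕ) : Measurable (Y i) := by
  rw [show Y i = Y₀ ∘ θ^[i] from funext fun ω => hY.eq_comp i ω]
  exact (hY.measurable_zero.mono hY.le le_rfl).comp (hY.preserving_iterate i).measurable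

lemma add_apply (hY : IsStationaryMixing F₀ P θ Y₀ Y e)
    (i k : ℕ) (ω : Ω) : Y (i + k) ω = Y k (θ^[i] ω) := by
  rw [hY.eq_comp, hY.eq_comp, add_comm, Function.iterate_add_apply]

lemma zero_eq (hY : IsStationaryMixing F₀ P θ Y₀ Y e) : Y 0 = Y₀ := funext fun ω => hY.eq_comp 0 ω

lemma map_eq (hY : IsStationaryMixing F₀ P θ Y₀ Y e) (i : ℕ) : P.map (Y i) = P.map Y₀ := by
  have hm : Measurable Y₀ := hY.measurable_zero.mono hY.le le_rfl
  rw [show Y i = Y₀ ∘ θ^[i] from funext fun ω => hY.eq_comp i ω,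
    ← Measure.map_map hm (hY.preserving_iterate i).measurable, (hY.preserving_iterate i).map_eq]

lemma setIntegral_shift (hY : IsStationaryMixing F₀ P θ Y₀ Y e)
    (i : ℕ) {B : Set Ω} (hB : MeasurableSet B) {u : Ω → ℝ}
    (hu : Measurable u) :
    ∫ ω in θ^[i] ⁻¹' B, u (θ^[i] ω) ∂P = ∫ ω in B, u ω ∂P := by
  have hm := (hY.preserving_iterate i).map_eq
  conv_rhs => rw [← hm]
  exact (setIntegral_map hB hu.aestronglyMeasurable
    (hY.preserving_iterate i).measurable.aemeasurable).symm

lemma measureReal_shift (hY : IsStationaryMixing F₀ P θ Y₀ Y e)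
    (i : ℕ) {B : Set Ω} (hB : MeasurableSet B) :
    P.real (θ^[i] ⁻¹' B) = P.real B :=
  (hY.preserving_iterate i).measureReal_preimage hB.nullMeasurableSet

variable {M T : ℝ} {h G : ℝ → ℝ}

lemma integral_comp_eq (hY : IsStationaryMixing F₀ P θ Y₀ Y e)
    {u : ℝ → ℝ} (hu : AEStronglyMeasurable u (P.map Y₀)) (i : ℕ) :
    ∫ ω, u (Y i ω) ∂P = ∫ x, u x ∂(P.map Y₀) := by
  rw [← hY.map_eq i, integral_map (hY.measurable i).aemeasurable (by rwa [hY.map_eq i])]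

lemma center_add (hY : IsStationaryMixing F₀ P θ Y₀ Y e) (hh : Measurable h) (i k : ℕ) (ω : Ω) :
    center P (fun ω => h (Y (i + k) ω)) ω = center P (fun ω => h (Y k ω)) (θ^[i] ω) := by
  simp only [center, hY.add_apply i k]
  congr 1
  have h1 := hY.setIntegral_shift i MeasurableSet.univ (hh.comp (hY.measurable k))
  simpa using h1

/-- Two uses of mixing. Shifted back by i, the covariance bound at lag j - i gives √e(j-i) times
second moments localized to the shifted event. Shifted forward again, these live on A in F₀, where
mixing at lags i and j extracts the factor P(A). -/
lemma abs_setIntegral_center_mul_center_le (hY : IsStationaryMixing F₀ P θ Y₀ Y e)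
    (H : IsBoundedMonComb M T (P.map Y₀) h G) (hT : 0 ≤ T)
    {A : Set Ω} (hA : MeasurableSet[F₀] A) {i j : ℕ} (hij : i < j) :
    |∫ ω in A, center P (fun ω => h (Y i ω)) ω * center P (fun ω => h (Y j ω)) ω ∂P| ≤
      P.real A * (√(e (j - i)) * (10 * M ^ 2 + 16 * e i * T ^ 2 + 4 * e j * T ^ 2)) := by
  have hAi : MeasurableSet[F₀.comap (θ^[i])] A := by
    have h0 : F₀ ≤ F₀.comap (θ^[i]) := by
      have := hY.comap_mono (Nat.zero_le i)
      simpa using this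
    exact h0 _ hA
  -- Since the σ-algebras increase along θ, the event A is also θ^{-i}B with B in F₀; hence both
  -- descriptions of the same event are available.
  obtain ⟨B, hB, rfl⟩ := hAi
  obtain ⟨k, rfl⟩ := Nat.exists_eq_add_of_lt hij
  have hk : i + k + 1 = i + (k + 1) := by ring
  rw [hk, Nat.add_sub_cancel_left]
  have hBm : MeasurableSet B := hY.le _ hB
  have hhm := H.measurable
  have hm : ∀ k, Measurable (center P fun ω => h (Y k ω)) := fun k =>
    measurable_center (hhm.comp (hY.measurable k))
  have hξF : Measurable[F₀] (center P fun ω => h (Y 0 ω)) := by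
    rw [hY.zero_eq]
    exact (hhm.comp hY.measurable_zero).sub_const _
  have e0 : ∀ ω, center P (fun ω => h (Y i ω)) ω = center P (fun ω => h (Y 0 ω)) (θ^[i] ω) :=
    fun ω => by simpa using hY.center_add hhm i 0 ω
  have e1 : ∫ ω in θ^[i] ⁻¹' B, center P (fun ω => h (Y i ω)) ω *
      center P (fun ω => h (Y (i + (k + 1)) ω)) ω ∂P =
      ∫ ω, B.indicator (center P fun ω => h (Y 0 ω)) ω *
        center P (fun ω => h (Y (k + 1) ω)) ω ∂P := by
    simp_rw [e0, hY.center_add hhm i (k + 1)]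
    rw [hY.setIntegral_shift i hBm (u := fun ω => center P (fun ω => h (Y 0 ω)) ω *
      center P (fun ω => h (Y (k + 1) ω)) ω) ((hm 0).mul (hm (k + 1))), ← integral_indicator hBm]
    refine integral_congr_ae (Filter.Eventually.of_forall fun ω => ?_)
    by_cases hω : ω ∈ B <;> simp [hω]
  rw [e1]
  have key := H.abs_integral_mul_center_le hY.le (hY.measurable (k + 1)) (hY.map_eq (k + 1))
    (hY.nonneg (k + 1)) (hY.disc (k + 1)) hT hBm
    (W := B.indicator (center P fun ω => h (Y 0 ω))) (hξF.indicator hB) (c := 2 * T) (fun ω => by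
      by_cases hω : ω ∈ B
      · simpa [hω] using H.abs_center_le (P := P) hT ω
      · simpa [hω] using hT) (fun ω hω => by simp [hω])
  refine key.trans ?_
  have e2 : ∫ ω, B.indicator (center P fun ω => h (Y 0 ω)) ω ^ 2 ∂P =
      ∫ ω in θ^[i] ⁻¹' B, center P (fun ω => h (Y i ω)) ω ^ 2 ∂P := by
    simp_rw [e0]
    rw [hY.setIntegral_shift i hBm (u := fun ω => center P (fun ω => h (Y 0 ω)) ω ^ 2)
      ((hm 0).pow_const 2), ← integral_indicator hBm]
    refine integral_congr_ae (Filter.Eventually.of_forall fun ω => ?_)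
    by_cases hω : ω ∈ B <;> simp [hω]
  have e3 : ∫ ω in B, G (Y (k + 1) ω) ∂P =
      ∫ ω in θ^[i] ⁻¹' B, G (Y (i + (k + 1)) ω) ∂P := by
    simp_rw [hY.add_apply i (k + 1)]
    rw [hY.setIntegral_shift i hBm (u := fun ω => G (Y (k + 1) ω))
      (H.measurable_sq.comp (hY.measurable _))]
  have b1 := H.setIntegral_center_sq_le hY.le (hY.measurable i) (hY.map_eq i)
    (hY.nonneg i) (hY.disc i) hT hA
  have b2 := H.setIntegral_sq_le hY.le (hY.measurable (i + (k + 1))) (hY.map_eq _)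
    (hY.nonneg _) (hY.disc _) hT hA
  rw [e2, e3, ← hY.measureReal_shift i hBm]
  calc _ ≤ √(e (k + 1)) * (2 * (P.real (θ^[i] ⁻¹' B) * (4 * M ^ 2 + 8 * e i * T ^ 2)) +
        P.real (θ^[i] ⁻¹' B) * (M ^ 2 + 4 * e (i + (k + 1)) * T ^ 2) +
        P.real (θ^[i] ⁻¹' B) * M ^ 2) := by gcongr
    _ = _ := by ring

/-- Eventually √e_k < 1, and then e_k ≤ √e_k. -/
lemma summable_rate (hY : IsStationaryMixing F₀ P θ Y₀ Y e) : Summable e := by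
  refine Summable.of_norm_bounded_eventually_nat hY.summable ?_
  have h0 : Filter.Tendsto (fun k => √(e k)) Filter.atTop (nhds 0) :=
    hY.summable.tendsto_atTop_zero
  filter_upwards [h0.eventually (gt_mem_nhds zero_lt_one)] with k hk
  rw [Real.norm_of_nonneg (hY.nonneg k)]
  calc e k = √(e k) * √(e k) := (Real.mul_self_sqrt (hY.nonneg k)).symm
    _ ≤ √(e k) * 1 := mul_le_mul_of_nonneg_left hk.le (Real.sqrt_nonneg _)
    _ = √(e k) := mul_one _

lemma sum_le_tsum_succ {f : ℕ → ℝ} (hf0 : ∀ k, 0 ≤ f k) (hf : Summable f) (s : Finset ℕ)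
    {τ : ℕ → ℕ} (hτ : Set.InjOn τ s) (hpos : ∀ j ∈ s, 0 < τ j) :
    ∑ j ∈ s, f (τ j) ≤ ∑' k, f (k + 1) := by
  have h1 : ∑ j ∈ s, f (τ j) = ∑ x ∈ s.image (fun j => τ j - 1), f (x + 1) := by
    rw [Finset.sum_image]
    · exact Finset.sum_congr rfl fun j hj => by rw [Nat.sub_add_cancel (hpos j hj)]
    · intro j hj j' hj' hjj'
      refine hτ hj hj' ?_
      have := hpos j hj
      have := hpos j' hj'
      simp only at hjj'
      omega
  rw [h1]
  exact ((summable_nat_add_iff 1).2 hf).sum_le_tsum _ fun k _ => hf0 _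

/-- Expand the square of the sum one new term at a time. -/
lemma setIntegral_partialSum_sq_le_sum (hY : IsStationaryMixing F₀ P θ Y₀ Y e)
    (H : IsBoundedMonComb M T (P.map Y₀) h G) (hT : 0 ≤ T)
    {A : Set Ω} (hA : MeasurableSet[F₀] A) (m : ℕ) :
    ∫ ω in A, partialSum P Y h m ω ^ 2 ∂P ≤ P.real A * ∑ j ∈ Finset.Icc 1 m,
      (4 * M ^ 2 + 8 * e j * T ^ 2 + 2 * ∑ i ∈ Finset.Ico 1 j,
        √(e (j - i)) * (10 * M ^ 2 + 16 * e i * T ^ 2 + 4 * e j * T ^ 2)) := by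
  have hm : ∀ k, Measurable (center P fun ω => h (Y k ω)) := fun k =>
    measurable_center (H.measurable.comp (hY.measurable k))
  have hi : ∀ i j, Integrable (fun ω => center P (fun ω => h (Y i ω)) ω *
      center P (fun ω => h (Y j ω)) ω) P := fun i j =>
    integrable_of_bounded ((hm i).mul (hm j)) (c := (2 * T) * (2 * T)) fun ω => by
      rw [abs_mul]
      exact mul_le_mul (H.abs_center_le hT ω) (H.abs_center_le hT ω) (abs_nonneg _) (by positivity)
  induction m with
  | zero => simp [partialSum]
  | succ m ih =>
    have hsum : Integrable (fun ω => partialSum P Y h m ω ^ 2) P := by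
      simp only [partialSum, sq, Finset.sum_mul_sum]
      exact integrable_finsetSum _ fun i _ => integrable_finsetSum _ fun j _ => hi i j
    have e1 : ∀ ω, partialSum P Y h (m + 1) ω ^ 2 = partialSum P Y h m ω ^ 2 +
        (center P (fun ω => h (Y (m + 1) ω)) ω ^ 2 + ∑ i ∈ Finset.Ico 1 (m + 1),
          2 * (center P (fun ω => h (Y i ω)) ω * center P (fun ω => h (Y (m + 1) ω)) ω)) := by
      intro ω
      have : partialSum P Y h (m + 1) ω = partialSum P Y h m ω +
          center P (fun ω => h (Y (m + 1) ω)) ω := by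
        simp only [partialSum]
        rw [Finset.sum_Icc_succ_top (by omega)]
      rw [this, ← Finset.mul_sum, ← Finset.sum_mul]
      have e2 : ∑ i ∈ Finset.Ico 1 (m + 1), center P (fun ω => h (Y i ω)) ω =
          partialSum P Y h m ω := by
        simp only [partialSum]
        rfl
      rw [e2]
      ring
    have hsq : Integrable (fun ω => center P (fun ω => h (Y (m + 1) ω)) ω ^ 2) P := by
      simpa only [sq] using hi (m + 1) (m + 1)
    have hcr : Integrable (fun ω => ∑ i ∈ Finset.Ico 1 (m + 1),
        2 * (center P (fun ω => h (Y i ω)) ω * center P (fun ω => h (Y (m + 1) ω)) ω)) P :=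
      integrable_finsetSum _ fun i _ => (hi i _).const_mul 2
    have hsc : Integrable (fun ω => center P (fun ω => h (Y (m + 1) ω)) ω ^ 2 +
        ∑ i ∈ Finset.Ico 1 (m + 1),
          2 * (center P (fun ω => h (Y i ω)) ω * center P (fun ω => h (Y (m + 1) ω)) ω)) P :=
      hsq.add hcr
    simp_rw [e1]
    rw [integral_add hsum.integrableOn hsc.integrableOn,
      integral_add hsq.integrableOn hcr.integrableOn,
      integral_finsetSum _ fun i _ => ((hi i _).const_mul 2).integrableOn,
      Finset.sum_Icc_succ_top (by omega), mul_add]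
    refine add_le_add ih ?_
    rw [mul_add]
    refine add_le_add (H.setIntegral_center_sq_le hY.le (hY.measurable _) (hY.map_eq _)
      (hY.nonneg _) (hY.disc _) hT hA) ?_
    rw [← mul_assoc, Finset.mul_sum]
    refine Finset.sum_le_sum fun i hi' => ?_
    rw [integral_const_mul]
    have := hY.abs_setIntegral_center_mul_center_le H hT hA (Finset.mem_Ico.1 hi').2
    have := (abs_le.1 this).2
    linarith

/-- The part depending on T does not grow with m: each of its terms carries a factor e i or e j,
summable along with √e. Only the M² terms accumulate linearly. -/
lemma setIntegral_partialSum_sq_le (hY : IsStationaryMixing F₀ P θ Y₀ Y e)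
    (H : IsBoundedMonComb M T (P.map Y₀) h G) (hT : 0 ≤ T)
    {A : Set Ω} (hA : MeasurableSet[F₀] A) (m : ℕ) :
    ∫ ω in A, partialSum P Y h m ω ^ 2 ∂P ≤ P.real A *
      (m * (M ^ 2 * (4 + 20 * ∑' k, √(e (k + 1)))) + T ^ 2 * (∑' k, e (k + 1)) *
        (8 + 40 * ∑' k, √(e (k + 1)))) := by
  refine (hY.setIntegral_partialSum_sq_le_sum H hT hA m).trans
    (mul_le_mul_of_nonneg_left ?_ measureReal_nonneg)
  set s := ∑' k, √(e (k + 1)) with hs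
  set Φ := ∑' k, e (k + 1) with hΦ
  have hs0 : 0 ≤ s := tsum_nonneg fun k => Real.sqrt_nonneg _
  have b1 : ∀ j, ∑ i ∈ Finset.Ico 1 j, √(e (j - i)) ≤ s := fun j =>
    sum_le_tsum_succ (f := fun k => √(e k)) (fun k => Real.sqrt_nonneg _) hY.summable _
      (τ := fun i => j - i) (fun i hi i' hi' h => by
        have := Finset.mem_Ico.1 hi; have := Finset.mem_Ico.1 hi'
        have h : j - i = j - i' := h
        omega)
      (fun i hi => by have := Finset.mem_Ico.1 hi; show 0 < j - i; omega)
  have b2 : ∀ i, ∑ j ∈ Finset.Ioc i m, √(e (j - i)) ≤ s := fun i =>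
    sum_le_tsum_succ (f := fun k => √(e k)) (fun k => Real.sqrt_nonneg _) hY.summable _
      (τ := fun j => j - i) (fun j hj j' hj' h => by
        have := Finset.mem_Ioc.1 hj; have := Finset.mem_Ioc.1 hj'
        have h : j - i = j' - i := h
        omega)
      (fun j hj => by have := Finset.mem_Ioc.1 hj; show 0 < j - i; omega)
  have b3 : ∑ j ∈ Finset.Icc 1 m, e j ≤ Φ :=
    sum_le_tsum_succ hY.nonneg hY.summable_rate _ (τ := fun j => j)
      (fun j _ j' _ h => h) (fun j hj => (Finset.mem_Icc.1 hj).1)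
  have b4 : ∑ j ∈ Finset.Icc 1 m, ∑ i ∈ Finset.Ico 1 j, √(e (j - i)) * e i ≤ s * Φ := by
    rw [Finset.sum_comm' (t' := Finset.Icc 1 m) (s' := fun i => Finset.Ioc i m) (fun j i => by
      simp only [Finset.mem_Icc, Finset.mem_Ico, Finset.mem_Ioc]; omega)]
    calc _ = ∑ i ∈ Finset.Icc 1 m, (∑ j ∈ Finset.Ioc i m, √(e (j - i))) * e i :=
          Finset.sum_congr rfl fun i _ => by rw [Finset.sum_mul]
      _ ≤ ∑ i ∈ Finset.Icc 1 m, s * e i := Finset.sum_le_sum fun i _ =>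
          mul_le_mul_of_nonneg_right (b2 i) (hY.nonneg i)
      _ = s * ∑ i ∈ Finset.Icc 1 m, e i := by rw [Finset.mul_sum]
      _ ≤ s * Φ := mul_le_mul_of_nonneg_left b3 hs0
  have term : ∀ j, 4 * M ^ 2 + 8 * e j * T ^ 2 + 2 * ∑ i ∈ Finset.Ico 1 j,
        √(e (j - i)) * (10 * M ^ 2 + 16 * e i * T ^ 2 + 4 * e j * T ^ 2) ≤
      (4 * M ^ 2 + 20 * M ^ 2 * s) + (8 * T ^ 2 + 8 * T ^ 2 * s) * e j +
        32 * T ^ 2 * ∑ i ∈ Finset.Ico 1 j, √(e (j - i)) * e i := by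
    intro j
    have e1 : ∑ i ∈ Finset.Ico 1 j,
        √(e (j - i)) * (10 * M ^ 2 + 16 * e i * T ^ 2 + 4 * e j * T ^ 2) =
        (10 * M ^ 2 + 4 * e j * T ^ 2) * ∑ i ∈ Finset.Ico 1 j, √(e (j - i)) +
        16 * T ^ 2 * ∑ i ∈ Finset.Ico 1 j, √(e (j - i)) * e i := by
      rw [Finset.mul_sum, Finset.mul_sum, ← Finset.sum_add_distrib]
      exact Finset.sum_congr rfl fun i _ => by ring
    have h2 : 0 ≤ 10 * M ^ 2 + 4 * e j * T ^ 2 := by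
      have := hY.nonneg j
      positivity
    have := mul_le_mul_of_nonneg_left (b1 j) h2
    rw [e1]
    linarith
  refine (Finset.sum_le_sum fun j _ => term j).trans ?_
  rw [Finset.sum_add_distrib, Finset.sum_add_distrib, ← Finset.mul_sum, ← Finset.mul_sum]
  simp only [Finset.sum_const, Nat.card_Icc, Nat.add_sub_cancel, nsmul_eq_mul]
  have h1 := mul_le_mul_of_nonneg_left b3 (show 0 ≤ 8 * T ^ 2 + 8 * T ^ 2 * s by positivity)
  have h2 := mul_le_mul_of_nonneg_left b4 (show 0 ≤ 32 * T ^ 2 by positivity)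
  nlinarith

end IsStationaryMixing

end SecondMoment

/-! ### Maximal inequality for bounded functions and cost of approximation. -/

section BoundedMaximal

variable {Ω : Type*} {F₀ : MeasurableSpace Ω} [mΩ : MeasurableSpace Ω] {P : Measure Ω}
  [IsProbabilityMeasure P] {θ : Ω ≃ᵐ Ω} {Y₀ : Ω → ℝ} {Y : ℕ → Ω → ℝ} {e : ℕ → ℝ}

namespace IsStationaryMixing

variable {M T : ℝ} {h G : ℝ → ℝ}

lemma partialSum_add_sub (hY : IsStationaryMixing F₀ P θ Y₀ Y e)
    (hh : Measurable h) (i m : ℕ) (ω : Ω) :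
    partialSum P Y h (i + m) ω - partialSum P Y h i ω = partialSum P Y h m (θ^[i] ω) := by
  induction m with
  | zero => simp [partialSum]
  | succ m ih =>
    have h1 : ∀ k ω, partialSum P Y h (k + 1) ω = partialSum P Y h k ω +
        center P (fun ω => h (Y (k + 1) ω)) ω := fun k ω => by
      simp only [partialSum]
      rw [Finset.sum_Icc_succ_top (by omega)]
    rw [← add_assoc, h1, h1, ← ih, add_assoc i m 1, hY.center_add hh]
    ring

lemma measurable_partialSum (hY : IsStationaryMixing F₀ P θ Y₀ Y e) (hh : Measurable h) (n : ℕ) :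
    Measurable[F₀.comap (θ^[n])] (partialSum P Y h n) := by
  unfold partialSum
  refine Finset.measurable_fun_sum _ fun k hk => ?_
  refine Measurable.mono ?_ (hY.comap_mono (Finset.mem_Icc.1 hk).2) le_rfl
  refine Measurable.sub_const ?_ _
  refine hh.comp ?_
  rw [show Y k = Y₀ ∘ θ^[k] from funext fun ω => hY.eq_comp k ω]
  exact hY.measurable_zero.comp (comap_measurable _)

lemma abs_partialSum_le (H : IsBoundedMonComb M T (P.map Y₀) h G) (hT : 0 ≤ T) (n : ℕ) (ω : Ω) :
    |partialSum P Y h n ω| ≤ n * (2 * T) := by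
  unfold partialSum
  refine (Finset.abs_sum_le_sum_abs _ _).trans
    ((Finset.sum_le_sum fun k _ => H.abs_center_le hT ω).trans (le_of_eq ?_))
  simp

/-- The maximal inequality for bounded functions. -/
lemma measureReal_exists_lt_abs_partialSum_le (hY : IsStationaryMixing F₀ P θ Y₀ Y e)
    (H : IsBoundedMonComb M T (P.map Y₀) h G)
    (hT : 0 ≤ T) (hM : 0 < M) {b : ℕ} (hb : 0 < b)
    (hTb : T ^ 2 * (∑' k, e (k + 1)) * (8 + 40 * ∑' k, √(e (k + 1))) ≤ b * M ^ 2) (n Q : ℕ) :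
    P.real {ω | ∃ k ≤ n, Q * (6 * √(M ^ 2 * (5 + 20 * ∑' k, √(e (k + 1))) * b) + 2 * T) <
      |partialSum P Y h k ω|} ≤ (12 : ℝ) ^ ((n : ℝ) / b) * (1 / 6) ^ Q := by
  have hs0 : 0 ≤ ∑' k, √(e (k + 1)) := tsum_nonneg fun k => Real.sqrt_nonneg _
  have hhm := H.measurable
  have hSm : ∀ n, Measurable (partialSum P Y h n) := fun n =>
    (hY.measurable_partialSum hhm n).mono (hY.comap_le n) le_rfl
  refine measureReal_exists_lt_abs_le (ℱ := fun i => F₀.comap (θ^[i])) hY.comap_le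
    hY.comap_mono (hY.measurable_partialSum hhm) ?_ hb ?_ ?_ ?_ ?_ n Q
  · have : (0 : ℝ) < b := by exact_mod_cast hb
    positivity
  · intro i j
    refine integrable_of_bounded (((hSm j).sub (hSm i)).pow_const 2)
      (c := (j * (2 * T) + i * (2 * T)) ^ 2) fun ω => ?_
    rw [abs_pow]
    refine pow_le_pow_left₀ (abs_nonneg _) ((abs_sub _ _).trans ?_) 2
    exact add_le_add (abs_partialSum_le H hT j ω) (abs_partialSum_le H hT i ω)
  · rintro i m hm A ⟨B, hB, rfl⟩
    have hBm := hY.le _ hB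
    simp_rw [hY.partialSum_add_sub hhm]
    rw [hY.setIntegral_shift i hBm (u := fun ω => partialSum P Y h m ω ^ 2)
      ((hSm m).pow_const 2), hY.measureReal_shift i hBm]
    -- The T² term is at most bM², which turns the coefficient 4 + 20s into 5 + 20s.
    refine (hY.setIntegral_partialSum_sq_le H hT hB m).trans ?_
    rw [mul_comm]
    refine mul_le_mul_of_nonneg_right ?_ measureReal_nonneg
    have hm' : (m : ℝ) ≤ b := by exact_mod_cast hm
    have h1 : (m : ℝ) * (M ^ 2 * (4 + 20 * ∑' k, √(e (k + 1)))) ≤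
      b * (M ^ 2 * (4 + 20 * ∑' k, √(e (k + 1)))) := by gcongr
    linarith
  · intro i ω
    rw [hY.partialSum_add_sub hhm i 1]
    simpa using abs_partialSum_le H hT 1 (θ^[i] ω)
  · intro ω
    simp [partialSum]

lemma center_sub {X X' : Ω → ℝ} (hX : Integrable X P) (hX' : Integrable X' P) (ω : Ω) :
    center P X ω - center P X' ω = center P (fun ω => X ω - X' ω) ω := by
  simp only [center]
  rw [integral_sub hX hX']
  ring

/-- The cost of replacing `f` by `h` in the maximum of the partial sums. -/
lemma measureReal_exists_lt_abs_partialSum_sub_le (hY : IsStationaryMixing F₀ P θ Y₀ Y e)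
    {f : ℝ → ℝ} (hf : Integrable f (P.map Y₀))
    (hh : Integrable h (P.map Y₀)) {x : ℝ} (hx : 0 < x) (n : ℕ) :
    P.real {ω | ∃ k ≤ n, x ≤ |partialSum P Y f k ω - partialSum P Y h k ω|} ≤
      2 * n * (∫ y, |f y - h y| ∂(P.map Y₀)) / x := by
  have hc : ∀ {u : ℝ → ℝ}, Integrable u (P.map Y₀) → ∀ k, Integrable (fun ω => u (Y k ω)) P :=
    fun hu k => by
      rw [← hY.map_eq k] at hu
      exact hu.comp_measurable (hY.measurable k)
  set R : ℝ := ∫ y, |f y - h y| ∂(P.map Y₀) with hR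
  have hfh : Integrable (fun y => f y - h y) (P.map Y₀) := hf.sub hh
  -- V dominates the difference of the partial sums for all k ≤ n at once, so Markov's inequality
  -- for V suffices; R accounts for the centering.
  set V : Ω → ℝ := fun ω => ∑ k ∈ Finset.Icc 1 n, (|f (Y k ω) - h (Y k ω)| + R) with hV
  have hVi : Integrable V P := integrable_finsetSum _ fun k _ =>
    (hc hfh k).abs.add (integrable_const R)
  have hVint : ∫ ω, V ω ∂P = 2 * n * R := by
    have hi : ∀ k, Integrable (fun ω => |f (Y k ω) - h (Y k ω)| + R) P := fun k =>
      (hc hfh k).abs.add (integrable_const R)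
    simp only [hV]
    rw [integral_finsetSum _ fun k _ => hi k]
    have : ∀ k, ∫ ω, (|f (Y k ω) - h (Y k ω)| + R) ∂P = 2 * R := fun k => by
      rw [integral_add (hc hfh k).abs (integrable_const R),
        hY.integral_comp_eq (u := fun y => |f y - h y|) hfh.abs.aestronglyMeasurable k]
      simp [hR]
      ring
    simp_rw [this]
    simp
    ring
  have hR0 : 0 ≤ R := integral_nonneg fun _ => abs_nonneg _
  have hV0 : ∀ ω, 0 ≤ V ω := fun ω => Finset.sum_nonneg fun k _ => by positivity
  have hsub : {ω | ∃ k ≤ n, x ≤ |partialSum P Y f k ω - partialSum P Y h k ω|} ⊆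
      {ω | x ≤ V ω} := by
    rintro ω ⟨k, hk, hxk⟩
    refine hxk.trans ?_
    simp only [partialSum]
    rw [← Finset.sum_sub_distrib]
    refine (Finset.abs_sum_le_sum_abs _ _).trans ?_
    refine (Finset.sum_le_sum_of_subset_of_nonneg (Finset.Icc_subset_Icc_right hk)
      fun i _ _ => abs_nonneg _).trans (Finset.sum_le_sum fun i _ => ?_)
    rw [center_sub (hc hf i) (hc hh i)]
    refine (abs_sub _ _).trans (add_le_add le_rfl ?_)
    refine (abs_integral_le_integral_abs).trans (le_of_eq ?_)
    exact hY.integral_comp_eq (u := fun y => |f y - h y|) hfh.abs.aestronglyMeasurable i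
  refine (measureReal_mono hsub).trans ?_
  rw [le_div_iff₀ hx, mul_comm, ← hVint]
  exact mul_meas_ge_le_integral_of_nonneg (Filter.Eventually.of_forall hV0) hVi x

end IsStationaryMixing

end BoundedMaximal

/-! ### Truncation and passage to the L¹ closure. -/

section Approximation

variable {μ : Measure ℝ} [IsProbabilityMeasure μ] {M c : ℝ} {T ψ : ℕ → ℝ}

lemma Mon.lintegral_enorm_sq_le {g : ℝ → ℝ} (hg : g ∈ Mon 2 M μ) :
    ∫⁻ x, ‖g x‖ₑ ^ 2 ∂μ ≤ ENNReal.ofReal (M ^ 2) := by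
  have h := hg.2
  simp only [Real.rpow_ofNat] at h
  refine le_trans (le_of_eq (lintegral_congr fun x => ?_)) h
  rw [ENNReal.ofReal_pow (abs_nonneg _), ← Real.norm_eq_abs, ofReal_norm]

lemma enorm_sub_truncate_eq (t : ℝ) (g : ℝ → ℝ) (x : ℝ) :
    ‖g x - truncate t g x‖ₑ = ‖g x‖ₑ * (if t < |g x| then 1 else 0) := by
  unfold truncate
  by_cases h : |g x| ≤ t
  · simp [h, not_lt.2 h]
  · simp [h, not_le.1 h]

/-- Summed against the weights `ψ`, the `L¹` errors of truncating a single function at the levels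
`T n` are controlled by its second moment. -/
lemma tsum_lintegral_sub_truncate_le (hc : 0 < c) (hψ : ∀ n, 0 ≤ ψ n)
    (hψT : ∀ g : ℝ, 0 ≤ g → ∀ N, ∑ n ∈ Finset.range N, (if T n < g then ψ n else 0) ≤ g / c)
    {g : ℝ → ℝ} (hg : g ∈ Mon 2 M μ) :
    ∑' n, ENNReal.ofReal (ψ n) * ∫⁻ x, ‖g x - truncate (T n) g x‖ₑ ∂μ ≤
      ENNReal.ofReal (M ^ 2 / c) := by
  have hgm := Mon.measurable hg
  have hmeas : ∀ n, Measurable fun x => ‖g x‖ₑ * (if T n < |g x| then (1 : ℝ≥0∞) else 0) :=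
    fun n => hgm.enorm.mul (Measurable.ite (measurableSet_lt measurable_const hgm.abs)
      measurable_const measurable_const)
  have hpt : ∀ x, ∑' n, ENNReal.ofReal (ψ n) * (‖g x‖ₑ * (if T n < |g x| then 1 else 0)) ≤
      ENNReal.ofReal (1 / c) * ‖g x‖ₑ ^ 2 := by
    intro x
    refine ENNReal.tsum_le_of_sum_range_le fun N => ?_
    have e1 : ∀ n, ENNReal.ofReal (ψ n) * (‖g x‖ₑ * (if T n < |g x| then 1 else 0)) =
        ENNReal.ofReal (if T n < |g x| then ψ n else 0) * ‖g x‖ₑ := fun n => by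
      split_ifs <;> simp
    simp_rw [e1]
    rw [← Finset.sum_mul, ← ENNReal.ofReal_sum_of_nonneg fun n _ => by
      split_ifs <;> simp [hψ n]]
    refine (mul_le_mul_left (ENNReal.ofReal_le_ofReal (hψT |g x| (abs_nonneg _) N)) _).trans
      (le_of_eq ?_)
    rw [div_eq_mul_one_div, mul_comm, ENNReal.ofReal_mul (abs_nonneg _), ← Real.norm_eq_abs,
      ofReal_norm]
    ring
  simp_rw [enorm_sub_truncate_eq]
  calc ∑' n, ENNReal.ofReal (ψ n) * ∫⁻ x, ‖g x‖ₑ * (if T n < |g x| then 1 else 0) ∂μ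
      = ∫⁻ x, ∑' n, ENNReal.ofReal (ψ n) * (‖g x‖ₑ * (if T n < |g x| then 1 else 0)) ∂μ := by
        rw [lintegral_tsum fun n => ((hmeas n).const_mul _).aemeasurable]
        simp_rw [lintegral_const_mul _ (hmeas _)]
    _ ≤ ∫⁻ x, ENNReal.ofReal (1 / c) * ‖g x‖ₑ ^ 2 ∂μ := lintegral_mono hpt
    _ = ENNReal.ofReal (1 / c) * ∫⁻ x, ‖g x‖ₑ ^ 2 ∂μ :=
        lintegral_const_mul _ (hgm.enorm.pow_const 2)
    _ ≤ ENNReal.ofReal (1 / c) * ENNReal.ofReal (M ^ 2) := by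
        gcongr
        exact Mon.lintegral_enorm_sq_le hg
    _ = ENNReal.ofReal (M ^ 2 / c) := by
        rw [← ENNReal.ofReal_mul (by positivity)]
        congr 1
        ring

/-- A finite combination has truncated versions with summable weighted `L¹` errors, with a bound
that depends on nothing but `M` and `c`. -/
lemma MonComb.exists_bounded (hc : 0 < c) (hψ : ∀ n, 0 ≤ ψ n) (hT : ∀ n, 0 ≤ T n)
    (hψT : ∀ g : ℝ, 0 ≤ g → ∀ N, ∑ n ∈ Finset.range N, (if T n < g then ψ n else 0) ≤ g / c)
    {f : ℝ → ℝ} (hf : f ∈ MonComb 2 M μ) :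
    Measurable f ∧ ∃ h G : ℕ → ℝ → ℝ, (∀ n, IsBoundedMonComb M (T n) μ (h n) (G n)) ∧
      ∑' n, ENNReal.ofReal (ψ n) * ∫⁻ x, ‖f x - h n x‖ₑ ∂μ ≤ ENNReal.ofReal (M ^ 2 / c) := by
  obtain ⟨L, a, g, hg, ha, rfl⟩ := hf
  have hgm := fun l => Mon.measurable (hg l)
  refine ⟨Finset.measurable_fun_sum _ fun l _ => (hgm l).const_mul _,
    fun n x => ∑ l, a l * truncate (T n) (g l) x,
    fun n x => ∑ l, |a l| * truncate (T n) (g l) x ^ 2, fun n => ⟨L, a,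
    fun l => truncate (T n) (g l), fun l => Mon.truncate_mem two_pos (hg l) (T n),
    fun l x => abs_truncate_le (hT n) _ _, ha, rfl, rfl⟩, ?_⟩
  have hm : ∀ n l, Measurable fun x => ‖g l x - truncate (T n) (g l) x‖ₑ := fun n l =>
    ((hgm l).sub (Mon.measurable (Mon.truncate_mem two_pos (hg l) (T n)))).enorm
  have h1 : ∀ n, ∫⁻ x, ‖(∑ l, a l * g l x) - ∑ l, a l * truncate (T n) (g l) x‖ₑ ∂μ ≤
      ∑ l, ‖a l‖ₑ * ∫⁻ x, ‖g l x - truncate (T n) (g l) x‖ₑ ∂μ := by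
    intro n
    simp_rw [← lintegral_const_mul _ (hm n _)]
    rw [← lintegral_finsetSum _ fun l _ => (hm n l).const_mul _]
    refine lintegral_mono fun x => ?_
    rw [← Finset.sum_sub_distrib]
    refine (enorm_sum_le _ _).trans (le_of_eq (Finset.sum_congr rfl fun l _ => ?_))
    rw [← mul_sub, enorm_mul]
  calc _ ≤ ∑' n, ∑ l, ‖a l‖ₑ *
        (ENNReal.ofReal (ψ n) * ∫⁻ x, ‖g l x - truncate (T n) (g l) x‖ₑ ∂μ) := by
        refine ENNReal.tsum_le_tsum fun n => ?_
        refine (mul_le_mul_right (h1 n) _).trans (le_of_eq ?_)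
        rw [Finset.mul_sum]
        exact Finset.sum_congr rfl fun l _ => by ring
    _ = ∑ l, ‖a l‖ₑ *
        ∑' n, (ENNReal.ofReal (ψ n) * ∫⁻ x, ‖g l x - truncate (T n) (g l) x‖ₑ ∂μ) := by
        rw [Summable.tsum_finsetSum fun l _ => ENNReal.summable]
        simp_rw [ENNReal.tsum_mul_left]
    _ ≤ ∑ l, ‖a l‖ₑ * ENNReal.ofReal (M ^ 2 / c) := by
        gcongr with l
        exact tsum_lintegral_sub_truncate_le hc hψ hψT (hg l)
    _ = (∑ l, ‖a l‖ₑ) * ENNReal.ofReal (M ^ 2 / c) := by rw [Finset.sum_mul]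
    _ ≤ 1 * ENNReal.ofReal (M ^ 2 / c) := by
        gcongr
        have : ∑ l, ‖a l‖ₑ = ENNReal.ofReal (∑ l, |a l|) := by
          rw [ENNReal.ofReal_sum_of_nonneg fun l _ => abs_nonneg _]
          exact Finset.sum_congr rfl fun l _ => by rw [← ofReal_norm, Real.norm_eq_abs]
        rw [this]
        exact ENNReal.ofReal_le_one.2 ha
    _ = _ := one_mul _

/-- Fatou's lemma for counting measure. -/
lemma tsum_liminf_le (u : ℕ → ℕ → ℝ≥0∞) :
    ∑' n, Filter.liminf (fun j => u j n) Filter.atTop ≤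
      Filter.liminf (fun j => ∑' n, u j n) Filter.atTop := by
  have := lintegral_liminf_le (u := Filter.atTop) (μ := (Measure.count : Measure ℕ)) (f := u)
    fun j => measurable_of_countable _
  simpa [lintegral_count] using this

/-- Elements of the closure are approximated by bounded combinations at all levels `T n`, with
summable weighted `L¹` errors. -/
lemma MonClosure.exists_bounded (hc : 0 < c) (hψ : ∀ n, 0 ≤ ψ n) (hT : ∀ n, 0 ≤ T n)
    (hψT : ∀ g : ℝ, 0 ≤ g → ∀ N, ∑ n ∈ Finset.range N, (if T n < g then ψ n else 0) ≤ g / c)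
    {f : ℝ → ℝ} (hf : f ∈ MonClosure 2 M μ) :
    ∃ h G : ℕ → ℝ → ℝ, (∀ n, IsBoundedMonComb M (T n) μ (h n) (G n)) ∧
      Summable fun n => ψ n * ∫ x, |f x - h n x| ∂μ := by
  obtain ⟨hfL, hfε⟩ := hf
  have hpos : ∀ j : ℕ, (0 : ℝ≥0∞) < ((j : ℝ≥0∞) + 1)⁻¹ := fun j => by
    rw [ENNReal.inv_pos]; finiteness
  choose f' hf' hlim using fun j : ℕ => hfε _ (hpos j)
  choose hfm h G H htsum using fun j => MonComb.exists_bounded hc hψ hT hψT (hf' j)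
  set u : ℕ → ℕ → ℝ≥0∞ := fun j n => ENNReal.ofReal (ψ n) * ∫⁻ x, ‖f' j x - h j n x‖ₑ ∂μ with hu
  set R : ℕ → ℝ≥0∞ := fun n => Filter.liminf (fun j => u j n) Filter.atTop with hR
  have hRsum : ∑' n, R n ≤ ENNReal.ofReal (M ^ 2 / c) := by
    refine (tsum_liminf_le u).trans ?_
    refine (Filter.liminf_le_liminf (Filter.Eventually.of_forall htsum)).trans (le_of_eq ?_)
    exact Filter.liminf_const _
  have hRfin : ∀ n, R n ≠ ∞ := fun n =>
    ((ENNReal.le_tsum n).trans_lt (hRsum.trans_lt ENNReal.ofReal_lt_top)).ne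
  have hε : ∀ n : ℕ, (0 : ℝ≥0∞) < (1 / 2) ^ n := fun n => by
    exact ENNReal.pow_pos (by simp) n
  have hclose : ∀ n, Filter.Tendsto (fun j : ℕ => ENNReal.ofReal (ψ n) * ((j : ℝ≥0∞) + 1)⁻¹)
      Filter.atTop (nhds 0) := by
    intro n
    have h1 : Filter.Tendsto (fun j : ℕ => ((j : ℝ≥0∞) + 1)⁻¹) Filter.atTop (nhds 0) := by
      have := (Filter.tendsto_add_atTop_iff_nat 1).2 ENNReal.tendsto_inv_nat_nhds_zero
      simpa using this
    simpa using ENNReal.Tendsto.const_mul h1 (Or.inr ENNReal.ofReal_ne_top)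
  -- A different approximant of f may be used for each n. It is taken with truncation error near its
  -- liminf over j, whose sum Fatou controls, and with weighted L¹ distance to f below 2^(-n).
  have hex : ∀ n, ∃ j, u j n < R n + (1 / 2) ^ n ∧
      ENNReal.ofReal (ψ n) * ((j : ℝ≥0∞) + 1)⁻¹ < (1 / 2) ^ n := by
    intro n
    have h1 : ∃ᶠ j in Filter.atTop, u j n < R n + (1 / 2) ^ n :=
      Filter.frequently_lt_of_liminf_lt (by isBoundedDefault)
        (ENNReal.lt_add_right (hRfin n) (hε n).ne')
    exact (h1.and_eventually ((hclose n).eventually (gt_mem_nhds (hε n)))).exists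
  choose J hJ1 hJ2 using hex
  refine ⟨fun n => h (J n) n, fun n => G (J n) n, fun n => H (J n) n, ?_⟩
  have hmeas : ∀ n, AEStronglyMeasurable (fun x => f x - h (J n) n x) μ := fun n =>
    hfL.aestronglyMeasurable.sub (H (J n) n).measurable.aestronglyMeasurable
  have hbound : ∀ n, ENNReal.ofReal (ψ n) * ∫⁻ x, ‖f x - h (J n) n x‖ₑ ∂μ ≤
      R n + 2 * (1 / 2) ^ n := by
    intro n
    have h2 : ∫⁻ x, ‖f x - f' (J n) x‖ₑ ∂μ ≤ ((J n : ℝ≥0∞) + 1)⁻¹ := by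
      have := hlim (J n)
      rw [eLpNorm_one_eq_lintegral_enorm] at this
      exact this.le
    have h3 : ∫⁻ x, ‖f x - h (J n) n x‖ₑ ∂μ ≤
        ∫⁻ x, ‖f x - f' (J n) x‖ₑ ∂μ + ∫⁻ x, ‖f' (J n) x - h (J n) n x‖ₑ ∂μ := by
      have hm : Measurable fun x => ‖f' (J n) x - h (J n) n x‖ₑ :=
        ((hfm (J n)).sub (H (J n) n).measurable).enorm
      rw [← lintegral_add_right _ hm]
      refine lintegral_mono fun x => ?_
      refine le_trans (le_of_eq ?_) (enorm_add_le _ _)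
      rw [sub_add_sub_cancel]
    calc _ ≤ ENNReal.ofReal (ψ n) * (((J n : ℝ≥0∞) + 1)⁻¹ +
          ∫⁻ x, ‖f' (J n) x - h (J n) n x‖ₑ ∂μ) := by
          gcongr
          exact h3.trans (add_le_add_left h2 _)
      _ = ENNReal.ofReal (ψ n) * ((J n : ℝ≥0∞) + 1)⁻¹ + u (J n) n := by rw [mul_add]
      _ ≤ (1 / 2) ^ n + (R n + (1 / 2) ^ n) := add_le_add (hJ2 n).le (hJ1 n).le
      _ = _ := by ring
  have hfin : ∑' n, ENNReal.ofReal (ψ n) * ∫⁻ x, ‖f x - h (J n) n x‖ₑ ∂μ ≠ ∞ := by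
    refine ((ENNReal.tsum_le_tsum hbound).trans_lt ?_).ne
    rw [ENNReal.tsum_add, ENNReal.tsum_mul_left, ENNReal.tsum_geometric]
    refine ENNReal.add_lt_top.2 ⟨hRsum.trans_lt ENNReal.ofReal_lt_top, ?_⟩
    rw [one_div, ENNReal.one_sub_inv_two, inv_inv]
    finiteness
  have := ENNReal.summable_toReal hfin
  refine this.congr fun n => ?_
  rw [ENNReal.toReal_mul, ENNReal.toReal_ofReal (hψ n)]
  congr 1
  rw [← integral_norm_eq_lintegral_enorm (hmeas n)]
  simp only [Real.norm_eq_abs]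

end Approximation

/-! ### Iterated logarithm weights, truncation levels and block lengths. -/

section Asymptotics

open Filter Real

/-- The weight `1 / √(n log log n)`. -/
noncomputable def lilWeight (n : ℕ) : ℝ := 1 / √(n * log (log n))

lemma lilWeight_nonneg (n : ℕ) : 0 ≤ lilWeight n := by
  unfold lilWeight; positivity

/-- The partial sums of `lilWeight`. -/
noncomputable def lilWeightSum (n : ℕ) : ℝ := ∑ k ∈ Finset.range (n + 1), lilWeight k

lemma lilWeightSum_nonneg (n : ℕ) : 0 ≤ lilWeightSum n :=
  Finset.sum_nonneg fun k _ => lilWeight_nonneg k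

/-- As `lilWeightSum` is nondecreasing, the condition selects an initial segment of indices. The
selected weights sum to `lilWeightSum` at the last one, which is below g/c. -/
lemma sum_lilWeight_le {c : ℝ} (hc : 0 < c) {g : ℝ} (hg : 0 ≤ g) (N : ℕ) :
    ∑ n ∈ Finset.range N, (if c * lilWeightSum n < g then lilWeight n else 0) ≤ g / c := by
  have h1 : ∀ N, ∑ n ∈ Finset.range N, (if c * lilWeightSum n < g then lilWeight n else 0) ≤
      ∑ n ∈ Finset.range N, lilWeight n := fun N => Finset.sum_le_sum fun n _ => by
    split_ifs
    · exact le_rfl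
    · exact lilWeight_nonneg n
  induction N with
  | zero => simpa using by positivity
  | succ N ih =>
    by_cases h : c * lilWeightSum N < g
    · refine (h1 (N + 1)).trans ?_
      rw [le_div_iff₀ hc, mul_comm]
      exact h.le
    · rw [Finset.sum_range_succ, if_neg h, add_zero]
      exact ih

lemma tendsto_log_natCast : Tendsto (fun n : ℕ => log (n : ℝ)) atTop atTop :=
  tendsto_log_atTop.comp tendsto_natCast_atTop_atTop

lemma tendsto_log_log_natCast : Tendsto (fun n : ℕ => log (log (n : ℝ))) atTop atTop :=
  tendsto_log_atTop.comp tendsto_log_natCast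

/-- The function √(x / log log x) has derivative of order 1/√(x log log x), because log log x varies
slowly; the constant 4 leaves room for that variation. -/
lemma lilWeight_succ_le : ∀ᶠ n : ℕ in atTop, lilWeight (n + 1) ≤
    4 * (√((n + 1 : ℕ) / log (log ((n + 1 : ℕ) : ℝ))) - √(n / log (log (n : ℝ)))) := by
  filter_upwards [tendsto_log_natCast.eventually_ge_atTop 2,
    tendsto_log_log_natCast.eventually_ge_atTop 1, eventually_ge_atTop 1] with n h1 h2 hn
  have hn0 : (0 : ℝ) < n := by exact_mod_cast hn
  set l := log (n : ℝ) with hl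
  set l' := log ((n + 1 : ℕ) : ℝ) with hl'
  have hll' : l ≤ l' := log_le_log hn0 (by push_cast; linarith)
  have d1 : l' - l ≤ 1 / n := by
    rw [hl, hl', ← log_div (by positivity) hn0.ne']
    refine (log_le_sub_one_of_pos (by positivity)).trans (le_of_eq ?_)
    push_cast
    field_simp
    ring
  -- The factor 1/2 comes from log n ≥ 2. It ensures that the growth of log log n eats at most half
  -- of the relative increase of n.
  have d2 : log l' - log l ≤ 1 / (2 * n) := by
    rw [← log_div (by linarith) (by linarith)]
    refine (log_le_sub_one_of_pos (div_pos (by linarith) (by linarith))).trans ?_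
    rw [div_sub_one (by linarith), div_le_iff₀ (by linarith)]
    refine d1.trans ?_
    rw [div_mul_eq_mul_div, div_le_div_iff₀ hn0 (by positivity)]
    nlinarith
  set L := log l with hL
  set L' := log l' with hL'
  have hLL' : L ≤ L' := log_le_log (by linarith) hll'
  have key : (n : ℝ) / L ≤ ((n + 1 : ℕ) / L') * (1 - 1 / (4 * (n + 1))) ^ 2 := by
    have e1 : 1 - 1 / (2 * ((n : ℝ) + 1)) ≤ (1 - 1 / (4 * ((n : ℝ) + 1))) ^ 2 := by
      have : (1 - 1 / (4 * ((n : ℝ) + 1))) ^ 2 = 1 - 1 / (2 * ((n : ℝ) + 1)) +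
        (1 / (4 * ((n : ℝ) + 1))) ^ 2 := by
        field_simp; ring
      rw [this]
      have := sq_nonneg (1 / (4 * ((n : ℝ) + 1)))
      linarith
    have hpos : (0 : ℝ) ≤ (n + 1 : ℕ) / L' := div_nonneg (by positivity) (by linarith)
    refine le_trans ?_ (mul_le_mul_of_nonneg_left e1 hpos)
    have e2 : ((n + 1 : ℕ) : ℝ) / L' * (1 - 1 / (2 * ((n : ℝ) + 1))) = (2 * n + 1) / (2 * L') := by
      have : L' ≠ 0 := by linarith
      push_cast
      field_simp
      ring
    rw [e2, div_le_div_iff₀ (by linarith) (by linarith)]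
    have e3 : 2 * n * (L' - L) ≤ 1 := by
      have := mul_le_mul_of_nonneg_left d2 (show 0 ≤ 2 * (n : ℝ) by positivity)
      have e4 : 2 * (n : ℝ) * (1 / (2 * n)) = 1 := by field_simp
      linarith
    linarith
  have hfac : (0 : ℝ) ≤ 1 - 1 / (4 * (n + 1)) := by
    rw [sub_nonneg, div_le_one (by positivity)]
    linarith
  have hsq : √(n / L) ≤ √((n + 1 : ℕ) / L') * (1 - 1 / (4 * (n + 1))) := by
    refine (sqrt_le_sqrt key).trans (le_of_eq ?_)
    rw [sqrt_mul (div_nonneg (by positivity) (by linarith)), sqrt_sq hfac]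
  have hw : lilWeight (n + 1) = √((n + 1 : ℕ) / L') * (1 / (n + 1)) := by
    have hL'0 : 0 < L' := by linarith
    unfold lilWeight
    rw [← hl', ← hL', sqrt_div (by positivity), sqrt_mul (by positivity)]
    have e1 : √((n + 1 : ℕ) : ℝ) * √((n + 1 : ℕ) : ℝ) = n + 1 := by
      rw [mul_self_sqrt (by positivity)]; push_cast; ring
    have e2 : √((n + 1 : ℕ) : ℝ) ≠ 0 := by positivity
    rw [← e1]
    field_simp
  rw [hw]
  have : √((n + 1 : ℕ) / L') * (1 - 1 / (4 * (n + 1))) = √((n + 1 : ℕ) / L') -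
      √((n + 1 : ℕ) / L') * (1 / (n + 1)) / 4 := by
    field_simp
  linarith

/-- Telescope the previous estimate; the initial constant is absorbed since n / log log n ≥ 1
eventually. -/
lemma lilWeightSum_le : ∃ C : ℝ, 0 < C ∧
    ∀ᶠ n : ℕ in atTop, lilWeightSum n ≤ C * √(n / log (log (n : ℝ))) := by
  obtain ⟨n₀, hn₀⟩ := eventually_atTop.1 lilWeight_succ_le
  have hD : ∀ n ≥ n₀, lilWeightSum n ≤ 4 * √(n / log (log (n : ℝ))) + lilWeightSum n₀ := by
    intro n hn
    induction n, hn using Nat.le_induction with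
    | base =>
      have := sqrt_nonneg (n₀ / log (log (n₀ : ℝ)))
      linarith
    | succ n hn ih =>
      have h1 := hn₀ n hn
      have h2 : lilWeightSum (n + 1) = lilWeightSum n + lilWeight (n + 1) :=
        Finset.sum_range_succ _ _
      linarith
  have h0 := lilWeightSum_nonneg n₀
  refine ⟨4 + lilWeightSum n₀, by linarith, ?_⟩
  filter_upwards [eventually_ge_atTop n₀, tendsto_log_log_natCast.eventually_ge_atTop 1,
    tendsto_log_natCast.eventually_ge_atTop 1, eventually_ge_atTop 1] with n hn hL hl h1
  have hn0 : (0 : ℝ) < n := by exact_mod_cast h1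
  have h2 : log (log (n : ℝ)) ≤ n := by
    have a1 := log_le_sub_one_of_pos hn0
    have a2 := log_le_sub_one_of_pos (show 0 < log (n : ℝ) by linarith)
    linarith
  have h3 : 1 ≤ √(n / log (log (n : ℝ))) := by
    rw [one_le_sqrt, one_le_div (by linarith)]
    exact h2
  have := hD n hn
  nlinarith

lemma one_lt_log_three : 1 < log 3 := by
  rw [lt_log_iff_exp_lt (by norm_num)]
  exact exp_one_lt_d9.trans (by norm_num)

/-- Cauchy condensation reduces this to Σ k^(-log 3), which converges because log 3 > 1. -/
lemma summable_one_div_mul_log_rpow :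
    Summable fun n : ℕ => 1 / (n : ℝ) * (log (n : ℝ)) ^ (-log 3) := by
  rw [← summable_condensed_iff_of_eventually_nonneg]
  · have h1 : Summable fun k : ℕ => (log 2) ^ (-log 3) * (k : ℝ) ^ (-log 3) :=
      (summable_nat_rpow.2 (by linarith [one_lt_log_three])).mul_left _
    refine h1.congr fun k => ?_
    push_cast
    rw [log_pow, mul_rpow (by positivity) (log_nonneg (by norm_num))]
    have : (2 : ℝ) ^ k ≠ 0 := by positivity
    field_simp
  · filter_upwards [eventually_ge_atTop 1] with n hn
    have : 0 ≤ log (n : ℝ) := log_nonneg (by exact_mod_cast hn)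
    simp only [Pi.zero_apply]
    positivity
  · filter_upwards [eventually_ge_atTop 2] with n hn
    have hn' : (1 : ℝ) < n := by exact_mod_cast hn
    have h0 : 0 < log (n : ℝ) := log_pos hn'
    have h1 : (log ((n + 1 : ℕ) : ℝ)) ^ (-log 3) ≤ (log (n : ℝ)) ^ (-log 3) :=
      rpow_le_rpow_of_nonpos h0 (log_le_log (by linarith) (by push_cast; linarith))
        (by linarith [one_lt_log_three])
    refine mul_le_mul ?_ h1 (rpow_nonneg (log_nonneg (by push_cast; linarith)) _) (by positivity)
    exact one_div_le_one_div_of_le (by linarith) (by push_cast; linarith)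

/-- The number of blocks, `⌈log log n⌉`. -/
noncomputable def lilBlocks (n : ℕ) : ℕ := ⌈log (log (n : ℝ))⌉₊

/-- The block length, `⌈n / lilBlocks n⌉`. -/
noncomputable def lilLength (n : ℕ) : ℕ := ⌈(n : ℝ) / lilBlocks n⌉₊

lemma eventually_lilLength : ∀ᶠ n : ℕ in atTop,
    0 < lilLength n ∧ (n : ℝ) / log (log n) ≤ 2 * lilLength n ∧
    (12 : ℝ) ^ ((n : ℝ) / lilLength n) * (1 / 6) ^ (2 * lilBlocks n) ≤ (log n) ^ (-log 3) ∧
    lilBlocks n * √(lilLength n) ≤ 1.04 * √(n * log (log n)) := by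
  have hlo : ∀ᶠ n : ℕ in atTop, 4 * log (n : ℝ) ^ 2 ≤ n := by
    have h1 := (isLittleO_pow_log_id_atTop (n := 2)).comp_tendsto
      (tendsto_natCast_atTop_atTop (R := ℝ))
    have h2 := h1.bound (show (0 : ℝ) < 1 / 4 by norm_num)
    filter_upwards [h2] with n hn
    simp only [Function.comp_apply, norm_pow, norm_eq_abs, sq_abs, id_eq, Nat.abs_cast] at hn
    linarith
  -- The two roundings give m²b ≤ (L + 2)n, so 1.04² = 1.0816 suffices once L ≥ 25; the value 30 is
  -- a convenient margin.
  filter_upwards [hlo, tendsto_log_log_natCast.eventually_ge_atTop 30,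
    tendsto_log_natCast.eventually_ge_atTop 1, eventually_ge_atTop 1] with n h4 hL hl h1
  have hn0 : (0 : ℝ) < n := by exact_mod_cast h1
  set l := log (n : ℝ) with hldef
  set L := log l with hLdef
  set m := lilBlocks n with hm
  set b := lilLength n with hb
  have hLl : L ≤ l := (log_le_sub_one_of_pos (by linarith)).trans (by linarith)
  have hmL : L ≤ m := Nat.le_ceil _
  have hmL' : (m : ℝ) < L + 1 := Nat.ceil_lt_add_one (by linarith)
  have hm0 : (0 : ℝ) < m := by linarith
  have hbm : (n : ℝ) / m ≤ b := Nat.le_ceil _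
  have hbm' : (b : ℝ) < n / m + 1 := Nat.ceil_lt_add_one (by positivity)
  have hb0 : (0 : ℝ) < b := lt_of_lt_of_le (by positivity) hbm
  refine ⟨by exact_mod_cast hb0, ?_, ?_, ?_⟩
  · have h2 : (n : ℝ) / L ≤ 2 * (n / m) := by
      rw [mul_div_assoc', div_le_div_iff₀ (by linarith) hm0]
      nlinarith
    linarith
  · have h2 : (n : ℝ) / b ≤ m := by
      rw [div_le_iff₀ hb0]
      rw [div_le_iff₀ hm0] at hbm
      linarith
    calc (12 : ℝ) ^ ((n : ℝ) / b) * (1 / 6) ^ (2 * m)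
        ≤ (12 : ℝ) ^ (m : ℝ) * (1 / 6) ^ (2 * m) := by
          gcongr
          norm_num
      -- Two moves per block: 12 · 6^(-2) = 1/3.
      _ = ((3 : ℝ)⁻¹) ^ m := by
          rw [rpow_natCast, pow_mul, ← mul_pow]
          norm_num
      _ = exp (-log 3 * m) := by
          rw [← rpow_natCast, rpow_def_of_pos (by norm_num), log_inv]
      _ ≤ exp (-log 3 * L) := by
          refine exp_le_exp.2 ?_
          nlinarith [one_lt_log_three]
      _ = l ^ (-log 3) := by
          rw [rpow_def_of_pos (by linarith), mul_comm]
  · have e1 : (m : ℝ) * √b = √(m ^ 2 * b) := by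
      rw [sqrt_mul (by positivity), sqrt_sq hm0.le]
    have e2 : 1.04 * √(n * L) = √(1.04 ^ 2 * (n * L)) := by
      rw [sqrt_mul (show (0 : ℝ) ≤ 1.04 ^ 2 by norm_num), sqrt_sq (by norm_num)]
    rw [e1, e2]
    refine sqrt_le_sqrt ?_
    have h2 : (m : ℝ) ^ 2 * b ≤ m * n + m ^ 2 := by
      have := mul_le_mul_of_nonneg_left hbm'.le (show (0 : ℝ) ≤ m ^ 2 by positivity)
      have e3 : (m : ℝ) ^ 2 * (n / m + 1) = m * n + m ^ 2 := by field_simp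
      linarith
    have h3 : (m : ℝ) ^ 2 ≤ n := by nlinarith
    nlinarith

end Asymptotics

/-! ### Properties of the mixing coefficients. -/

section Coefficients

variable {Ω : Type*} {F : MeasurableSpace Ω} [mΩ : MeasurableSpace Ω] {P : Measure Ω}
  [IsProbabilityMeasure P]

/-- Finiteness guarantees that the `toReal` in `phiCoeff` keeps the actual supremum. -/
lemma phi_le_two {l : ℕ} {Z : Fin l → Ω → ℝ} (hZ : ∀ j, Measurable (Z j)) :
    phi F P Z ≤ 2 := by
  refine iSup_le fun x => ?_
  set R : Ω → ℝ := fun ω => ∏ j, center P ({ω' | Z j ω' ≤ x j}.indicator 1) ω with hR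
  have hRb : ∀ ω, |R ω| ≤ 1 := fun ω => by
    rw [hR, Finset.abs_prod]
    exact Finset.prod_le_one (fun j _ => abs_nonneg _)
      fun j _ => abs_center_indicator_le (hZ j measurableSet_Iic) ω
  have h1 : ∀ᵐ ω ∂P, |(P[R | F]) ω| ≤ 1 :=
    ae_bdd_abs_condExp_of_ae_bdd_abs (R := (1 : ℝ)) (Filter.Eventually.of_forall hRb)
  have h2 : |∫ ω, (P[R | F]) ω ∂P| ≤ 1 := by
    simpa using norm_integral_le_of_norm_le_const (μ := P) (f := P[R | F]) (C := 1) h1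
  rw [eLpNorm_exponent_top]
  refine (eLpNormEssSup_le_of_ae_bound (C := 2) ?_).trans (by simp)
  filter_upwards [h1] with ω hω
  calc ‖center P (P[R | F]) ω‖ ≤ |(P[R | F]) ω| + |∫ ω, (P[R | F]) ω ∂P| := abs_sub _ _
    _ ≤ 2 := by linarith

variable {Y : ℕ → Ω → ℝ}

lemma iSup_phi_ne_top (hY : ∀ i, Measurable (Y i)) (k n : ℕ) :
    (⨆ (l : ℕ) (_ : 1 ≤ l ∧ l ≤ k) (i : Fin l → ℕ) (_ : Monotone i ∧ ∀ j, n ≤ i j),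
      phi F P (fun j => Y (i j))) ≠ ∞ :=
  ne_top_of_le_ne_top (b := 2) (by simp) <| iSup_le fun _ => iSup_le fun _ => iSup_le fun i =>
    iSup_le fun _ => phi_le_two fun j => hY (i j)

lemma phi_le_phiCoeff (hY : ∀ i, Measurable (Y i)) {n i : ℕ} (hi : n ≤ i) :
    phi F P (fun _ : Fin 1 => Y i) ≤ ENNReal.ofReal (phiCoeff F P Y 1 n) := by
  rw [phiCoeff, ENNReal.ofReal_toReal (iSup_phi_ne_top hY 1 n)]
  exact le_iSup_of_le 1 <| le_iSup_of_le ⟨le_rfl, le_rfl⟩ <| le_iSup_of_le (fun _ => i) <|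
    le_iSup_of_le ⟨monotone_const, fun _ => hi⟩ le_rfl

lemma phiCoeff_mono (hY : ∀ i, Measurable (Y i)) {k k' : ℕ} (hk : k ≤ k') (n : ℕ) :
    phiCoeff F P Y k n ≤ phiCoeff F P Y k' n :=
  ENNReal.toReal_mono (iSup_phi_ne_top hY k' n) <| iSup_mono fun _ =>
    iSup_mono' fun h => ⟨⟨h.1, h.2.trans hk⟩, le_rfl⟩

lemma phiCoeff_nonneg (k n : ℕ) : 0 ≤ phiCoeff F P Y k n := ENNReal.toReal_nonneg

/-- One-point coefficients are dominated by two-point ones, and the exponent 1/√3 - 1/2 is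
nonnegative since √3 ≤ 2. -/
lemma summable_sqrt_phiCoeff_one (hY : ∀ i, Measurable (Y i))
    (hφ : Summable fun k : ℕ => (k : ℝ) ^ (1 / √3 - 1 / 2 : ℝ) * √(phiCoeff F P Y 2 k)) :
    Summable fun k : ℕ => √(phiCoeff F P Y 1 k) := by
  refine Summable.of_norm_bounded_eventually_nat hφ ?_
  filter_upwards [Filter.eventually_ge_atTop 1] with k hk
  rw [Real.norm_of_nonneg (Real.sqrt_nonneg _)]
  have h1 : √(phiCoeff F P Y 1 k) ≤ √(phiCoeff F P Y 2 k) :=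
    Real.sqrt_le_sqrt (phiCoeff_mono hY one_le_two k)
  have h2 : (1 : ℝ) ≤ (k : ℝ) ^ (1 / √3 - 1 / 2 : ℝ) := by
    refine Real.one_le_rpow (by exact_mod_cast hk) ?_
    rw [sub_nonneg]
    refine one_div_le_one_div_of_le (by positivity) ?_
    rw [Real.sqrt_le_left (by norm_num)]
    norm_num
  calc √(phiCoeff F P Y 1 k) ≤ 1 * √(phiCoeff F P Y 2 k) := by rw [one_mul]; exact h1
    _ ≤ _ := mul_le_mul_of_nonneg_right h2 (Real.sqrt_nonneg _)

end Coefficients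

/-! ### Choice of constants and conclusion. -/

section Main

variable {Ω : Type*} {F₀ : MeasurableSpace Ω} [mΩ : MeasurableSpace Ω] {P : Measure Ω}
  [IsProbabilityMeasure P] {θ : Ω ≃ᵐ Ω} {Y₀ : Ω → ℝ} {Y : ℕ → Ω → ℝ} {e : ℕ → ℝ}

namespace IsStationaryMixing

variable {M : ℝ}

/-- If the rate at time zero is less than `1/2`, then the variables are almost surely constant. -/
lemma exists_ae_eq_const (hY : IsStationaryMixing F₀ P θ Y₀ Y e)
    (he : e 0 < 1 / 2) : ∃ c, ∀ᵐ ω ∂P, Y₀ ω = c := by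
  have hY₀ : Measurable Y₀ := hY.measurable_zero.mono hY.le le_rfl
  have h01 : ∀ x, P.real {ω | Y₀ ω ≤ x} = 0 ∨ P.real {ω | Y₀ ω ≤ x} = 1 := by
    intro x
    set B : Set Ω := {ω | Y₀ ω ≤ x} with hB
    have hBF : MeasurableSet[F₀] B := hY.measurable_zero measurableSet_Iic
    have hBm : MeasurableSet B := hY.le _ hBF
    have hd := hY.disc 0 x
    rw [hY.zero_eq] at hd
    have hdisc : ∀ A : Set Ω, MeasurableSet[F₀] A →
        |P.real (A ∩ B) - P.real A * P.real B| ≤ e 0 * P.real A := by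
      intro A hA
      have hAm := hY.le _ hA
      have h1 := hd (A.indicator 1) (Measurable.indicator (@measurable_const _ _ _ F₀ 1) hA)
        ⟨1, fun ω => by by_cases h : ω ∈ A <;> simp [h]⟩
      have e1 : ∫ ω, A.indicator (1 : Ω → ℝ) ω * center P (B.indicator 1) ω ∂P =
          P.real (A ∩ B) - P.real A * P.real B := by
        rw [← integral_indicator_one (hAm.inter hBm), ← integral_indicator_one hAm,
          ← integral_mul_const, ← integral_sub ((integrable_const 1).indicator (hAm.inter hBm))
          (((integrable_const 1).indicator hAm).mul_const _)]
        refine integral_congr_ae (Filter.Eventually.of_forall fun ω => ?_)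
        simp only [center_indicator hBm]
        by_cases h : ω ∈ A <;> by_cases h' : ω ∈ B <;> simp [h, h']
      have e2 : ∫ ω, |A.indicator (1 : Ω → ℝ) ω| ∂P = P.real A := by
        rw [← integral_indicator_one hAm]
        refine integral_congr_ae (Filter.Eventually.of_forall fun ω => ?_)
        by_cases h : ω ∈ A <;> simp [h]
      rwa [e1, e2] at h1
    -- Testing B against itself and against its complement gives p(1-p) ≤ e_0 p and p(1-p) ≤
    -- e_0(1-p). If 0 < p < 1, both p and 1 - p are at most e_0 < 1/2, which is impossible.
    have k1 := hdisc B hBF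
    have k2 := hdisc Bᶜ hBF.compl
    rw [Set.inter_self] at k1
    rw [Set.compl_inter_self, measureReal_empty, probReal_compl_eq_one_sub hBm] at k2
    set p := P.real B with hp
    have hp0 : 0 ≤ p := measureReal_nonneg
    have hp1 : p ≤ 1 := measureReal_le_one
    by_contra hcon
    push Not at hcon
    have hp0' : 0 < p := lt_of_le_of_ne hp0 (Ne.symm hcon.1)
    have hp1' : p < 1 := lt_of_le_of_ne hp1 hcon.2
    have a1 := (abs_le.1 k1).2
    have a2 := (abs_le.1 k2).1
    have a3 : 1 - p ≤ e 0 := by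
      by_contra h
      push Not at h
      nlinarith
    have a4 : p ≤ e 0 := by
      by_contra h
      push Not at h
      nlinarith
    linarith
  -- A distribution function with values 0 and 1 only is that of a constant; rational thresholds
  -- keep the exceptional set null.
  have hae : ∀ᵐ ω ∂P, ∀ q : ℚ, (Y₀ ω ≤ q ↔ P.real {ω | Y₀ ω ≤ q} = 1) := by
    rw [ae_all_iff]
    intro q
    have hBm : MeasurableSet {ω | Y₀ ω ≤ q} := hY₀ measurableSet_Iic
    rcases h01 q with h | h
    · have h' : P {ω | Y₀ ω ≤ q} = 0 := by rwa [measureReal_eq_zero_iff] at h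
      filter_upwards [measure_eq_zero_iff_ae_notMem.1 h'] with ω hω
      have hω' : ¬ Y₀ ω ≤ q := hω
      simp [hω', h]
    · have h' : P {ω | Y₀ ω ≤ q}ᶜ = 0 := by
        rw [← measureReal_eq_zero_iff, probReal_compl_eq_one_sub hBm, h, sub_self]
      filter_upwards [measure_eq_zero_iff_ae_notMem.1 h'] with ω hω
      have hω' : Y₀ ω ≤ q := not_not.1 hω
      simp [hω', h]
  obtain ⟨ω₀, hω₀⟩ := hae.exists
  refine ⟨Y₀ ω₀, ?_⟩
  filter_upwards [hae] with ω hω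
  refine le_antisymm ?_ ?_ <;> refine le_of_forall_gt_imp_ge_of_dense fun x hx => ?_ <;>
    obtain ⟨q, hq1, hq2⟩ := exists_rat_btwn hx
  · exact ((hω q).2 ((hω₀ q).1 hq1.le)).trans hq2.le
  · exact ((hω₀ q).2 ((hω q).1 hq1.le)).trans hq2.le

lemma ae_partialSum_eq_zero (hY : IsStationaryMixing F₀ P θ Y₀ Y e)
    {c : ℝ} (hc : ∀ᵐ ω ∂P, Y₀ ω = c) (f : ℝ → ℝ) :
    ∀ᵐ ω ∂P, ∀ n, partialSum P Y f n ω = 0 := by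
  have h1 : ∀ k, ∀ᵐ ω ∂P, Y k ω = c := fun k => by
    filter_upwards [(hY.preserving_iterate k).quasiMeasurePreserving.ae hc] with ω hω
    rw [hY.eq_comp, hω]
  have h2 : ∀ k, ∫ ω, f (Y k ω) ∂P = f c := fun k => by
    rw [integral_congr_ae (g := fun _ => f c) ((h1 k).mono fun ω hω => by simp [hω])]
    simp
  filter_upwards [ae_all_iff.2 h1] with ω hω n
  simp [partialSum, center, h2, hω]

lemma exists_lt_abs_of_lt_maxPartialSum {f : ℝ → ℝ} {n : ℕ} {x : ℝ} (hx : 0 ≤ x) {ω : Ω}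
    (h : x < maxPartialSum P Y f n ω) : ∃ k ≤ n, x < |partialSum P Y f k ω| := by
  lift x to ℝ≥0 using hx
  rw [NNReal.coe_lt_coe, maxPartialSum, Finset.lt_sup_iff] at h
  obtain ⟨k, hk, hxk⟩ := h
  refine ⟨k, (Finset.mem_Icc.1 hk).2, ?_⟩
  rw [← Real.norm_eq_abs, ← coe_nnnorm]
  exact_mod_cast hxk

/-- Truncation levels at which the maximal inequality for bounded functions yields a summable
bound. -/
lemma exists_truncation (hY : IsStationaryMixing F₀ P θ Y₀ Y e) (hM : 0 < M) : ∃ c : ℝ, 0 < c ∧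
    ∀ᶠ n : ℕ in Filter.atTop, ∀ h G : ℝ → ℝ,
      IsBoundedMonComb M (c * lilWeightSum n) (P.map Y₀) h G →
      P.real {ω | ∃ k ≤ n, 13 * √(M ^ 2 * (5 + 20 * ∑' k, √(e (k + 1)))) *
        √(n * Real.log (Real.log n)) < |partialSum P Y h k ω|} ≤
        (Real.log n) ^ (-Real.log 3) := by
  obtain ⟨C, hC, hCn⟩ := lilWeightSum_le
  set s := ∑' k, √(e (k + 1)) with hs
  set Φ := ∑' k, e (k + 1) with hΦ
  have hs0 : 0 ≤ s := tsum_nonneg fun k => Real.sqrt_nonneg _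
  have hΦ0 : 0 ≤ Φ := tsum_nonneg fun k => hY.nonneg _
  -- With T ≤ ε√b, this ε is small enough both for the jump term 2T to be minor next to 6K√b and for
  -- the T² part of the variance to be at most bM².
  set ε : ℝ := M / (8 * ((1 + s) * (1 + Φ))) with hε
  have hε0 : 0 < ε := by positivity
  have hεK : ε ≤ √(M ^ 2 * (5 + 20 * s)) / 8 := by
    have h1 : M ≤ √(M ^ 2 * (5 + 20 * s)) := by
      refine Real.le_sqrt_of_sq_le ?_
      nlinarith [sq_nonneg M]
    have h2 : ε ≤ M / 8 := by
      refine div_le_div_of_nonneg_left hM.le (by norm_num) ?_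
      nlinarith [mul_nonneg hs0 hΦ0]
    linarith
  have hεM : ε ^ 2 * Φ * (8 + 40 * s) ≤ M ^ 2 := by
    have h1 : ε ^ 2 * Φ * (8 + 40 * s) =
        M ^ 2 * ((Φ * (8 + 40 * s)) / (64 * ((1 + s) * (1 + Φ)) ^ 2)) := by
      rw [hε]; field_simp; ring
    rw [h1]
    refine mul_le_of_le_one_right (sq_nonneg M) ?_
    rw [div_le_one (by positivity)]
    have a1 : Φ ≤ (1 + Φ) ^ 2 := by nlinarith
    have a2 : 8 + 40 * s ≤ 64 * (1 + s) ^ 2 := by nlinarith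
    have := mul_le_mul a1 a2 (by positivity) (by positivity)
    linarith
  refine ⟨ε / (2 * C), by positivity, ?_⟩
  filter_upwards [hCn, eventually_lilLength, tendsto_log_log_natCast.eventually_ge_atTop 1]
    with n hn ⟨hb0, hnb, hprob, hthr⟩ hL h G H
  set T := ε / (2 * C) * lilWeightSum n with hT
  set b := lilLength n with hb
  have hT0 : 0 ≤ T := mul_nonneg (by positivity) (lilWeightSum_nonneg n)
  have hTb : T ≤ ε * √b := by
    have h1 : √(n / Real.log (Real.log n)) ≤ 2 * √b := by
      have h2 : √(n / Real.log (Real.log n)) ≤ √((2 : ℝ) ^ 2 * b) := by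
        refine Real.sqrt_le_sqrt (hnb.trans ?_)
        have : (0 : ℝ) ≤ b := by positivity
        linarith
      rwa [Real.sqrt_mul (by positivity), Real.sqrt_sq (by norm_num)] at h2
    calc T ≤ ε / (2 * C) * (C * √(n / Real.log (Real.log n))) := by
          rw [hT]; gcongr
      _ ≤ ε / (2 * C) * (C * (2 * √b)) := by gcongr
      _ = ε * √b := by field_simp
  have hTsq : T ^ 2 * Φ * (8 + 40 * s) ≤ b * M ^ 2 := by
    have h1 : T ^ 2 ≤ ε ^ 2 * b := by
      have := pow_le_pow_left₀ hT0 hTb 2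
      rwa [mul_pow ε, Real.sq_sqrt (by positivity)] at this
    calc T ^ 2 * Φ * (8 + 40 * s) ≤ (ε ^ 2 * b) * Φ * (8 + 40 * s) := by gcongr
      _ = b * (ε ^ 2 * Φ * (8 + 40 * s)) := by ring
      _ ≤ b * M ^ 2 := by gcongr
  -- With 2m moves of size 6K√b + 2T ≤ 6.25K√b, the threshold is at most 12.5 · 1.04 = 13 times K√(n
  -- log log n).
  refine le_trans ?_ ((hY.measureReal_exists_lt_abs_partialSum_le H hT0 hM hb0 hTsq n
    (2 * lilBlocks n)).trans hprob)
  refine measureReal_mono ?_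
  rintro ω ⟨k, hk, hkω⟩
  refine ⟨k, hk, lt_of_le_of_lt ?_ hkω⟩
  set K := √(M ^ 2 * (5 + 20 * s)) with hK
  have hK0 : 0 ≤ K := Real.sqrt_nonneg _
  rw [Real.sqrt_mul (by positivity)]
  push_cast
  have hTK : T ≤ K / 8 * √b := hTb.trans (mul_le_mul_of_nonneg_right hεK (Real.sqrt_nonneg _))
  calc 2 * (lilBlocks n : ℝ) * (6 * (K * √b) + 2 * T)
      ≤ 2 * (lilBlocks n : ℝ) * (6 * (K * √b) + 2 * (K / 8 * √b)) := by gcongr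
    _ = 12.5 * K * (lilBlocks n * √b) := by ring
    _ ≤ 12.5 * K * (1.04 * √(n * Real.log (Real.log n))) := by gcongr
    _ = 13 * K * √(n * Real.log (Real.log n)) := by ring

lemma summable_measureReal_lt_maxPartialSum (hY : IsStationaryMixing F₀ P θ Y₀ Y e)
    (hM : 0 < M) {f : ℝ → ℝ}
    (hf : f ∈ MonClosure 2 M (P.map Y₀)) :
    Summable fun n : ℕ => 1 / (n : ℝ) *
      P.real {ω | 3 * (16 * ∑' k, √(e k)) * M * √(n * Real.log (Real.log n)) <
        maxPartialSum P Y f n ω} := by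
  set s := ∑' k, √(e (k + 1)) with hs
  have hs0 : 0 ≤ s := tsum_nonneg fun k => Real.sqrt_nonneg _
  have hsum : ∑' k, √(e k) = √(e 0) + s := hY.summable.tsum_eq_zero_add
  have hA0 : 0 ≤ 3 * (16 * ∑' k, √(e k)) * M := by
    rw [hsum]; positivity
  rcases lt_or_ge (e 0) (1 / 2) with he | he
  -- The degenerate case must be separated: if e_0 = 0 and s = 0 the threshold is zero while K is
  -- not.
  · obtain ⟨c, hc⟩ := hY.exists_ae_eq_const he
    refine summable_zero.congr fun n => ?_
    have : P {ω | 3 * (16 * ∑' k, √(e k)) * M * √(n * Real.log (Real.log n)) <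
        maxPartialSum P Y f n ω} = 0 := by
      rw [measure_eq_zero_iff_ae_notMem]
      filter_upwards [hY.ae_partialSum_eq_zero hc f] with ω hω hcon
      have hx : 0 ≤ 3 * (16 * ∑' k, √(e k)) * M * √(n * Real.log (Real.log n)) := by positivity
      obtain ⟨k, -, hk⟩ := exists_lt_abs_of_lt_maxPartialSum hx hcon
      rw [hω k, abs_zero] at hk
      linarith
    rw [measureReal_def, this, ENNReal.toReal_zero, mul_zero]
  set K := √(M ^ 2 * (5 + 20 * s)) with hK
  have hK0 : 0 < K := by positivity
  have hAK : 13.5 * K ≤ 3 * (16 * ∑' k, √(e k)) * M := by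
    have hr : 0.7 ≤ √(e 0) := by
      refine Real.le_sqrt_of_sq_le (le_trans (by norm_num) he)
    have hr2 : √(e 0) ^ 2 = e 0 := Real.sq_sqrt (hY.nonneg 0)
    rw [hK, Real.sqrt_mul (sq_nonneg M), Real.sqrt_sq hM.le, hsum]
    have h1 : 13.5 * √(5 + 20 * s) ≤ 48 * (√(e 0) + s) := by
      have h2 : 13.5 * √(5 + 20 * s) = √(13.5 ^ 2 * (5 + 20 * s)) := by
        rw [Real.sqrt_mul (show (0 : ℝ) ≤ 13.5 ^ 2 by norm_num), Real.sqrt_sq (by norm_num)]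
      rw [h2]
      refine Real.sqrt_le_iff.2 ⟨by positivity, ?_⟩
      -- The difference of the two sides is bounded below by a positive quadratic in s, whose
      -- minimum lies near 0.09.
      nlinarith [mul_le_mul_of_nonneg_right hr hs0, sq_nonneg (s - 0.09)]
    nlinarith
  have hμ : IsProbabilityMeasure (P.map Y₀) :=
    Measure.isProbabilityMeasure_map (hY.measurable_zero.mono hY.le le_rfl).aemeasurable
  obtain ⟨c, hc, hcn⟩ := hY.exists_truncation hM
  have hT0 : ∀ n, 0 ≤ c * lilWeightSum n := fun n => mul_nonneg hc.le (lilWeightSum_nonneg n)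
  obtain ⟨h, G, H, hhG⟩ := MonClosure.exists_bounded (μ := P.map Y₀) hc lilWeight_nonneg
    hT0 (fun g hg N => sum_lilWeight_le hc hg N) hf
  refine Summable.of_norm_bounded_eventually_nat
    (summable_one_div_mul_log_rpow.add (hhG.mul_left (4 / K))) ?_
  filter_upwards [hcn, tendsto_log_log_natCast.eventually_ge_atTop 1,
    Filter.eventually_ge_atTop 1] with n hn hL hn1
  have hn0 : (0 : ℝ) < n := by exact_mod_cast hn1
  set R := ∫ x, |f x - h n x| ∂(P.map Y₀) with hR
  set q := √(n * Real.log (Real.log n)) with hq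
  have hq0 : 0 < q := Real.sqrt_pos.2 (mul_pos hn0 (by linarith))
  have hfi : Integrable f (P.map Y₀) := memLp_one_iff_integrable.1 hf.1
  have hhi : Integrable (h n) (P.map Y₀) :=
    integrable_of_bounded (H n).measurable fun x => (H n).abs_le (hT0 n) x
  have p1 := hn (h n) (G n) (H n)
  have p2 := hY.measureReal_exists_lt_abs_partialSum_sub_le hfi hhi
    (show 0 < K / 2 * q by positivity) n
  -- The margin 13.5K is split into 13K for the truncated sums and K/2 for the approximation error.
  have hsub : {ω | 3 * (16 * ∑' k, √(e k)) * M * q < maxPartialSum P Y f n ω} ⊆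
      {ω | ∃ k ≤ n, 13 * K * q < |partialSum P Y (h n) k ω|} ∪
      {ω | ∃ k ≤ n, K / 2 * q ≤ |partialSum P Y f k ω - partialSum P Y (h n) k ω|} := by
    intro ω hω
    obtain ⟨k, hk, hkω⟩ := exists_lt_abs_of_lt_maxPartialSum (by positivity) hω
    by_cases hcase : 13 * K * q < |partialSum P Y (h n) k ω|
    · exact Or.inl ⟨k, hk, hcase⟩
    · refine Or.inr ⟨k, hk, ?_⟩
      have h1 := abs_sub_abs_le_abs_sub (partialSum P Y f k ω) (partialSum P Y (h n) k ω)
      have h2 := mul_le_mul_of_nonneg_right hAK hq0.le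
      push Not at hcase
      linarith
  have hP := (measureReal_mono hsub).trans ((measureReal_union_le _ _).trans (add_le_add p1 p2))
  rw [Real.norm_of_nonneg (by positivity)]
  -- The factor n in Markov's bound cancels 1/n, leaving (4/K) times R/√(n log log n), precisely the
  -- weighted error known to be summable.
  refine (mul_le_mul_of_nonneg_left hP (by positivity)).trans (le_of_eq ?_)
  rw [mul_add]
  congr 1
  rw [lilWeight, ← hq, ← hR]
  field_simp
  ring

end IsStationaryMixing

end Main

end PhiLIL

theorem proposition5p2 {Ω : Type*} (F₀ : MeasurableSpace Ω) [mΩ : MeasurableSpace Ω]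
    (P : Measure Ω) [IsProbabilityMeasure P]
    (θ : Ω ≃ᵐ Ω) (hθ : MeasurePreserving θ P P)
    (hF₀ : F₀ ≤ mΩ) (hF₀θ : F₀ ≤ F₀.comap θ)
    (Y₀ : Ω → ℝ) (hY₀ : Measurable[F₀] Y₀)
    (Y : ℕ → Ω → ℝ) (hY : ∀ i ω, Y i ω = Y₀ (θ^[i] ω))
    (hφ : Summable fun k : ℕ =>
      (k : ℝ) ^ (1 / √3 - 1 / 2 : ℝ) * √(PhiLIL.phiCoeff F₀ P Y 2 k))
    (M : ℝ) (hM : 0 < M) (f : ℝ → ℝ) (hf : f ∈ PhiLIL.MonClosure 2 M (P.map Y₀))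
    (C : ℝ) (hC : C = 16 * ∑' k : ℕ, √(PhiLIL.phiCoeff F₀ P Y 1 k)) :
    (Summable fun k : ℕ => √(PhiLIL.phiCoeff F₀ P Y 1 k)) ∧
    Summable fun n : ℕ => 1 / (n : ℝ) *
      P.real {ω | 3 * C * M * √(n * Real.log (Real.log n)) < PhiLIL.maxPartialSum P Y f n ω} := by
  have hYm : ∀ i, Measurable (Y i) := fun i => by
    rw [show Y i = Y₀ ∘ θ^[i] from funext fun ω => hY i ω]
    exact (hY₀.mono hF₀ le_rfl).comp (hθ.iterate i).measurable
  have hsum := PhiLIL.summable_sqrt_phiCoeff_one hYm hφ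
  have H : PhiLIL.IsStationaryMixing F₀ P θ Y₀ Y (PhiLIL.phiCoeff F₀ P Y 1) :=
    { preserving := hθ
      le := hF₀
      le_comap := hF₀θ
      measurable_zero := hY₀
      eq_comp := hY
      nonneg := fun k => PhiLIL.phiCoeff_nonneg 1 k
      disc := fun k x => PhiLIL.condDiscrepancyLE_of_phi hF₀ (hYm k)
        (PhiLIL.phi_le_phiCoeff hYm le_rfl) (PhiLIL.phiCoeff_nonneg 1 k) x
      summable := hsum }
  refine ⟨hsum, ?_⟩
  subst hC
  exact H.summable_measureReal_lt_maxPartialSum hM hf
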